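/- Let $h_0=1.26$ and $\mathrm{sol}_0=3\arccos(1/3)-\pi$. For a set $V\subset\mathbb R^3$ let $E_2(V)$ be the set of pairs $\{v,w\}\subset V$ with $\|v-w\|=2$, and $E^+(V)$ the set of pairs $\{v,w\}\subset V$ with $2\le\|v-w\|<\sqrt8$. For a finite set $S\subset\mathbb R^3$ let $C(S)$ be the set of all linear combinations of elements of $S$ with nonnegative coefficients (so $C(\varnothing)=\{0\}$). A pair $(V,E)$ of a set $V\subset\mathbb R^3$ and a set $E$ of unordered pairs of distinct elements of $V$ is a *fan* if $V$ is finite and nonempty, $0\notin V$, the points $0,v,w$ are not collinear for any $\{v,w\}\in E$, and $C(\varepsilon)\cap C(\varepsilon')=C(\varepsilon\cap\varepsilon')$ for all $\varepsilon,\varepsilon'\in E\cup\{\{v\}:v\in V\}$. Set $Y(V,E)=\mathbb R^3\setminus\bigcup_{\varepsilon\in E}C(\varepsilon)$. Let $\mathcal V'$ be the class of sets $V\subset\mathbb R^3$ of exactly twelve points, all of norm $2$, such that any two distinct $u,v\in V$ satisfy $\|u-v\|=2$ or $\|u-v\|\ge 2h_0$, such that $(V,E^+(V))$ is a fan, and such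 that the graph $(V,E^+(V))$ is biconnected (connected, and without a node whose deletion increases the number of components). Let $(V,E)$ be a fan, and let $E(v)=\{w:\{v,w\}\in E\}$. For $v\in V$ let $\mathrm{azim}(v,u,p)\in[0,2\pi)$ be the angle from $u$ to $p$ about the axis through $0$ and $v$, measured counterclockwise with respect to the direction $v$; for $w\in E(v)$ let $\sigma(v,w)\in E(v)$ be the counterclockwise next neighbour of $v$ after $w$ (with $\sigma(v,w)=w$ if $E(v)=\{w\}$). The *darts* are the nonisolated darts $(v,w)$ with $\{v,w\}\in E$ and the isolated darts $(v,v)$ with $v\in V$, $E(v)=\varnothing$. The maps $n(v,w)=(v,\sigma(v,w))$, $e(v,w)=(w,v)$, $f(v,w)=(w,\sigma(w,\cdot)^{-1}v)$ on nonisolated darts, and the identity on isolated darts, make the set of darts a hypermap $\mathrm{hyp}(V,E)$; its *combinatorial components* are the classes of the equivalence relation generated by $n,e,f$. The *wedge* of a dart $(v,w)$ is $\{p: 0<\mathrm{azim}(v,w,p)<\theta\}$, where $\theta=\mathrm{azim}(v,w,\sigma(v,w))$ if $v$ has at least two neighbours and $\theta=2\pi$ if $E(v)=\{w\}$; the wedge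 of an isolated dart $(v,v)$ is the complement of the line through $0$ and $v$. A dart at $v$ *leads into* a subset $U$ if for all sufficiently small $\epsilon>0$ the set $U$, the open ball of radius $\epsilon$ at $v$, and the wedge of the dart have a common point. Now let $V\in\mathcal V'$. For a topological connected component $U$ of $Y(V,E_2(V))$ let $D_U$ be the set of darts of $\mathrm{hyp}(V,E_2(V))$ that lead into $U$, let $r_U$ be the number of nonisolated darts in $D_U$, let $2+s_U$ be twice the number of combinatorial components of $\mathrm{hyp}(V,E_2(V))$ that meet $D_U$, let $k_U=r_U+s_U$, and let $$\tau(U)=\mathrm{sol}(U)+(2-k_U)\,\mathrm{sol}_0,$$ where $\mathrm{sol}(U)$ is the solid angle of $U$ at the origin, that is, the area of the part of the unit sphere that lies in $U$. Then $Y(V,E_2(V))$ has finitely many topological connected components, and $$\sum_{U}\tau(U)=4\pi-20\,\mathrm{sol}_0,$$ where $U$ runs over these components. Moreover $|4\pi-20\,\mathrm{sol}_0-1.54065|<10^{-5}$. -/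

import Mathlib

noncomputable section

namespace KissingTwelve

open scoped Topology

/-- Euclidean three-space. -/
abbrev R3 := EuclideanSpace ℝ (Fin 3)

/-! ### Packings on the sphere of radius two -/

/-- A packing of unit balls, given by its set of centers. -/
def IsPacking (V : Set R3) : Prop :=
  ∀ v ∈ V, ∀ w ∈ V, ‖v - w‖ < 2 → v = w

/-- The truncation parameter `h₀ = 1.26`. -/
def h0 : ℝ := 1.26

/-- The class `𝒱` of packings of twelve points on the sphere of radius two, in which two distinct
points have distance exactly `2` or at least `2 h₀`. -/
def packings12 : Set (Set R3) :=
  {V | IsPacking V ∧ V.encard = 12 ∧ V ⊆ Metric.sphere 0 2 ∧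
    ∀ u ∈ V, ∀ v ∈ V, u = v ∨ ‖u - v‖ = 2 ∨ 2 * h0 ≤ ‖u - v‖}

/-- The contact edges `E₂(V)`: pairs of points of `V` at distance two. -/
def E2 (V : Set R3) : Set (Set R3) :=
  {ε | ∃ v ∈ V, ∃ w ∈ V, ‖v - w‖ = 2 ∧ ε = {v, w}}

/-- The edges `E⁺(V)`: pairs of points of `V` with distance in `[2, √8)`. -/
def EPlus (V : Set R3) : Set (Set R3) :=
  {ε | ∃ v ∈ V, ∃ w ∈ V, 2 ≤ ‖v - w‖ ∧ ‖v - w‖ < √8 ∧ ε = {v, w}}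

/-! ### Fans -/

/-- The closed cone `C(S) = aff₊({0}, S)`: all linear combinations of points of `S` with
nonnegative coefficients (the coefficient of the origin is free, so that the condition that the
coefficients sum to one imposes nothing). In particular `C(∅) = {0}`. -/
def cone (S : Set R3) : Set R3 := (PointedCone.hull ℝ S : Set R3)

/-- A fan `(V, E)`: `E` is a set of unordered pairs of distinct elements of `V`, and the
cardinality, origin, nonparallel and intersection conditions hold. -/
structure IsFan (V : Set R3) (E : Set (Set R3)) : Prop where
  edges : ∀ ε ∈ E, ∃ v ∈ V, ∃ w ∈ V, v ≠ w ∧ ε = {v, w}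
  finite : V.Finite
  nonempty : V.Nonempty
  origin : (0 : R3) ∉ V
  nonparallel : ∀ v w : R3, ({v, w} : Set R3) ∈ E → ¬ Collinear ℝ ({0, v, w} : Set R3)
  intersection : ∀ ε ∈ E ∪ {s | ∃ v ∈ V, s = {v}}, ∀ ε' ∈ E ∪ {s | ∃ v ∈ V, s = {v}},
    cone ε ∩ cone ε' = cone (ε ∩ ε')

/-- The graph with vertex set `V` and edge set `E`. -/
def fanGraph (V : Set R3) (E : Set (Set R3)) : SimpleGraph V where
  Adj v w := v ≠ w ∧ ({(v : R3), (w : R3)} : Set R3) ∈ E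
  symm := ⟨fun v w h => ⟨h.1.symm, by rw [Set.pair_comm]; exact h.2⟩⟩
  loopless := ⟨fun _ h => h.1 rfl⟩

/-- A graph is biconnected if it is connected and has no articulation node, that is, if the
deletion of a node never increases the number of components. -/
def IsBiconnected {α : Type*} (G : SimpleGraph α) : Prop :=
  G.Connected ∧ ∀ a : α, (G.induce {a}ᶜ).Preconnected

/-- The class `𝒱'` of those `V` in `𝒱` for which `(V, E⁺(V))` is a fan that is biconnected as a
graph. -/
def packings12' : Set (Set R3) :=
  {V | V ∈ packings12 ∧ IsFan V (EPlus V) ∧ IsBiconnected (fanGraph V (EPlus V))}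

/-- `X(V, E)`, the union of the closed blades of the fan. -/
def X (_V : Set R3) (E : Set (Set R3)) : Set R3 := ⋃ ε ∈ E, cone ε

/-- `Y(V, E)`, the complement of `X(V, E)`. -/
def Y (V : Set R3) (E : Set (Set R3)) : Set R3 := (X V E)ᶜ

/-- `[A]`, the set of topological connected components of a subset `A` of space. -/
def topComponents (A : Set R3) : Set (Set R3) :=
  {U | ∃ p ∈ A, U = connectedComponentIn A p}

/-! ### Azimuth angles and the hypermap of a fan -/

/-- The determinant of three vectors. -/
def det3 (a b c : R3) : ℝ :=
  Matrix.det !![a 0, a 1, a 2; b 0, b 1, b 2; c 0, c 1, c 2]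

/-- The azimuth angle `azim(0, v, u, w) ∈ [0, 2π)`, for `v ≠ 0`: the angle from `u` to `w` about
the axis through `v`, counterclockwise with respect to the direction `v`. If `π` is the
projection to the plane orthogonal to `v`, identified with `ℂ` so that
`(π⁻¹(1), π⁻¹(i), v / ‖v‖)` is a positively oriented orthonormal basis, then the complex number
below is `π(w) * conj (π(u))`, which has the argument of `π(w) / π(u)`. -/
def azim (v u w : R3) : ℝ :=
  toIcoMod Real.two_pi_pos 0
    (Complex.arg ⟨inner ℝ u w - inner ℝ u v * inner ℝ w v / ‖v‖ ^ 2, det3 v u w / ‖v‖⟩)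

/-- `E(v)`, the set of points adjacent to `v`. -/
def nbrs (E : Set (Set R3)) (v : R3) : Set R3 := {w | ({v, w} : Set R3) ∈ E}

open Classical in
/-- `σ(v, w)`, for `w ∈ E(v)`: the next element of `E(v)` after `w` in counterclockwise order
about `v`. It is `w` itself if `w` is the only element of `E(v)`. -/
def sigma (E : Set (Set R3)) (v w : R3) : R3 :=
  if h : ∃ u ∈ nbrs E v, u ≠ w ∧ ∀ u' ∈ nbrs E v, u' ≠ w → azim v w u ≤ azim v w u' then
    h.choose
  else w

/-- The nonisolated darts. -/
def darts1 (_V : Set R3) (E : Set (Set R3)) : Set (R3 × R3) := {x | ({x.1, x.2} : Set R3) ∈ E}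

/-- The isolated darts. -/
def darts2 (V : Set R3) (E : Set (Set R3)) : Set (R3 × R3) :=
  {x | x.1 ∈ V ∧ nbrs E x.1 = ∅ ∧ x.2 = x.1}

/-- The darts of `hyp(V, E)`. -/
def darts (V : Set R3) (E : Set (Set R3)) : Set (R3 × R3) := darts1 V E ∪ darts2 V E

open Classical in
/-- The node map `n` of `hyp(V, E)`. -/
def nodeMap (E : Set (Set R3)) (x : R3 × R3) : R3 × R3 :=
  if x.2 = x.1 then x else (x.1, sigma E x.1 x.2)

open Classical in
/-- The face map `f` of `hyp(V, E)`; `f (v, w) = (w, σ(w)⁻¹ v)` on nonisolated darts. -/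
def faceMap (E : Set (Set R3)) (x : R3 × R3) : R3 × R3 :=
  if x.2 = x.1 then x else (x.2, Function.invFunOn (sigma E x.2) (nbrs E x.2) x.1)

/-- The edge map `e` of `hyp(V, E)`, which is the identity on isolated darts. -/
def edgeMap (x : R3 × R3) : R3 × R3 := (x.2, x.1)

/-- One application of a structure map of `hyp(V, E)` leads from the dart `x` to the dart `y`. -/
def hypStep (V : Set R3) (E : Set (Set R3)) (x y : R3 × R3) : Prop :=
  x ∈ darts V E ∧ y ∈ darts V E ∧ (y = edgeMap x ∨ y = nodeMap E x ∨ y = faceMap E x)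

/-- The combinatorial components of `hyp(V, E)`: the classes of the equivalence relation on darts
that is generated by the structure maps. -/
def combComponents (V : Set R3) (E : Set (Set R3)) : Set (Set (R3 × R3)) :=
  {K | ∃ x ∈ darts V E, K = {y | y ∈ darts V E ∧ Relation.EqvGen (hypStep V E) x y}}

open Classical in
/-- The open wedge `W⁰_dart(x)` of a dart `x = (v, w)`: the points with azimuth strictly between
that of `w` and that of `σ(v, w)`. If `w` is the only node adjacent to `v`, the angle of the dart
is `2π`, and the wedge is the complement of a half-plane; if `x` is isolated, the wedge is the
complement of the line through `0` and `v`. -/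
def wedge (E : Set (Set R3)) (x : R3 × R3) : Set R3 :=
  if nbrs E x.1 = ∅ then {p | p ∉ Submodule.span ℝ {x.1}}
  else if nbrs E x.1 = {x.2} then {p | 0 < azim x.1 x.2 p ∧ azim x.1 x.2 p < 2 * Real.pi}
  else {p | 0 < azim x.1 x.2 p ∧ azim x.1 x.2 p < azim x.1 x.2 (sigma E x.1 x.2)}

/-- `D_U`, the set of darts of `hyp(V, E)` that lead into `U`. -/
def dartsInto (V : Set R3) (E : Set (Set R3)) (U : Set R3) : Set (R3 × R3) :=
  {x | x ∈ darts V E ∧ ∀ᶠ ε in 𝓝[>] (0 : ℝ), (U ∩ Metric.ball x.1 ε ∩ wedge E x).Nonempty}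

/-! ### The weight of a topological component -/

/-- The solid angle of `U` at the origin: the area of the part of the unit sphere in `U`. -/
def sol (U : Set R3) : ℝ :=
  (MeasureTheory.volume : MeasureTheory.Measure R3).toSphere.real
    ((↑) ⁻¹' U : Set (Metric.sphere (0 : R3) 1))

/-- The solid angle of a spherical equilateral triangle with sides of arclength `π / 3`. -/
def sol0 : ℝ := 3 * Real.arccos (1 / 3) - Real.pi

/-- `r_U`, the number of nonisolated darts in `D_U`. -/
def rU (V : Set R3) (E : Set (Set R3)) (U : Set R3) : ℕ :=
  (dartsInto V E U ∩ darts1 V E).ncard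

/-- `s_U`, where `2 + s_U` is twice the number of combinatorial components that meet `D_U`. -/
def sU (V : Set R3) (E : Set (Set R3)) (U : Set R3) : ℤ :=
  2 * ({K ∈ combComponents V E | (K ∩ dartsInto V E U).Nonempty}.ncard : ℤ) - 2

/-- `k_U = r_U + s_U`. -/
def kU (V : Set R3) (E : Set (Set R3)) (U : Set R3) : ℤ := (rU V E U : ℤ) + sU V E U

/-- The weight `τ(U) = sol(U) + (2 - k_U) sol₀` of a topological component `U` of
`Y(V, E₂(V))`. -/
def tau (V : Set R3) (U : Set R3) : ℝ := sol U + (2 - (kU V (E2 V) U : ℝ)) * sol0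

end KissingTwelve

end

/-!
The solid angles of the faces (the topological components of the complement of the blades) add up
to `4π`, because the blades lie in finitely many planes (`IsFan.sum_sol`). It remains to see that
the numbers `2 - k_U` add up to `4 - 2 |V|`, and this holds for every fan (`IsFan.sum_kU`). Every
dart leads into exactly one face (`IsFan.mem_dartsInto_iff`). So if `F`, `e`, `c` are the numbers
of faces, edges and combinatorial components, and `I` is the number of pairs of a face and a
component that has a dart leading into that face, then the sum is `4 F - 2 e - 2 I`, and one needs
`F + |V| = 1 + e + c` (Euler's formula, `IsFan.ncard_faces`) and `I + |V| = e + 2 c`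
(`IsFan.ncard_incidences`).

Both come from linear algebra over `ZMod 2`. A function on the faces has jumps across the edges.
Functions without jumps are constant (`IsFan.face_const`): two faces can be joined by a segment
that crosses the blades only in their relative interiors. The sets of edges that occur as jumps are
exactly the even ones, those that meet every node in an even number of edges. Jumps are even because
consecutive edges at a node share a face (`IsFan.dface_sigma`, `IsFan.sum_jump`). Conversely,
every even set of edges separates its complement in two colours, which is the Jordan curve
theorem modulo two (`exists_parity_function`, `IsFan.exists_jump`). The space of even sets has
dimension `e - |V| + c`, being the orthogonal complement of the coboundaries of functions on the
nodes. For `I` the same argument is applied to functions on the incident pairs; those without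
jumps are the functions of the component, since going around a component by the structure maps
of the hypermap one visits all its incidences (`IsFan.eq_of_cls_eq`).

The parity function of an even set of arcs counts, modulo two, the triangles that contain a
point when the arcs are coned off from a general point `o`. By the cocycle relation
`coneInd_cocycle` it depends on `o` only up to a constant, so that near a point `x` one may
take `o` close to `-x`, and then no cone over an arc that misses `x` comes near `x`. That relation
is a statement about signs of determinants, forced by the three-term Grassmann–Plücker relations.
-/

noncomputable section

namespace KissingTwelve

open scoped Topology
open Set Filter

/-! ### Determinants, cross products and cones in three-space -/

theorem inner_eq_coord (a b : R3) : inner ℝ a b = a 0 * b 0 + a 1 * b 1 + a 2 * b 2 := by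
  simp [PiLp.inner_apply, Fin.sum_univ_three]; ring

theorem norm_sq_eq_coord (a : R3) : ‖a‖ ^ 2 = a 0 ^ 2 + a 1 ^ 2 + a 2 ^ 2 := by
  rw [← real_inner_self_eq_norm_sq, inner_eq_coord]; ring

theorem det3_eq_coord (a b c : R3) : det3 a b c =
    a 0 * (b 1 * c 2 - b 2 * c 1) - a 1 * (b 0 * c 2 - b 2 * c 0)
      + a 2 * (b 0 * c 1 - b 1 * c 0) := by
  simp [det3, Matrix.det_fin_three]; ring

/-- The cross product. -/
def cr (a b : R3) : R3 :=
  !₂[a 1 * b 2 - a 2 * b 1, a 2 * b 0 - a 0 * b 2, a 0 * b 1 - a 1 * b 0]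

@[simp] theorem cr_zero (a b : R3) : cr a b 0 = a 1 * b 2 - a 2 * b 1 := rfl
@[simp] theorem cr_one (a b : R3) : cr a b 1 = a 2 * b 0 - a 0 * b 2 := rfl
@[simp] theorem cr_two (a b : R3) : cr a b 2 = a 0 * b 1 - a 1 * b 0 := rfl

theorem ext3 {a b : R3} (h0 : a 0 = b 0) (h1 : a 1 = b 1) (h2 : a 2 = b 2) : a = b := by
  ext i; fin_cases i <;> assumption

theorem det3_cr (a b : R3) : det3 a b (cr a b) = ‖cr a b‖ ^ 2 := by
  rw [det3_eq_coord, norm_sq_eq_coord]; simp only [cr_zero, cr_one, cr_two]; ring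

theorem det3_swap (a b p : R3) : det3 b a p = -det3 a b p := by
  simp only [det3_eq_coord]; ring

theorem det3_swap' (a b p : R3) : det3 a p b = -det3 a b p := by
  simp only [det3_eq_coord]; ring

theorem det3_rot (a b p : R3) : det3 a b p = det3 p a b := by
  simp only [det3_eq_coord]; ring

/-- Cramer's rule, without division. -/
theorem cramer (a b c p : R3) :
    det3 a b c • p = det3 p b c • a + det3 a p c • b + det3 a b p • c := by
  apply ext3 <;>
  · simp only [det3_eq_coord, PiLp.add_apply, PiLp.smul_apply, smul_eq_mul]; ring

/-- The determinant is linear in each argument; stated for combinations in the last one. -/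
theorem det3_comb (a b p q : R3) (s t : ℝ) :
    det3 a b (s • p + t • q) = s * det3 a b p + t * det3 a b q := by
  simp only [det3_eq_coord, PiLp.add_apply, PiLp.smul_apply, smul_eq_mul]; ring

theorem det3_self_left (a b : R3) : det3 a b a = 0 := by simp only [det3_eq_coord]; ring

theorem det3_self_right (a b : R3) : det3 a b b = 0 := by simp only [det3_eq_coord]; ring

theorem continuous_det3 {X : Type*} [TopologicalSpace X] {f g h : X → R3} (hf : Continuous f)
    (hg : Continuous g) (hh : Continuous h) : Continuous fun x => det3 (f x) (g x) (h x) := by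
  simp only [det3_eq_coord]; fun_prop

theorem cr_ne_zero_of_not_collinear {v w : R3} (h : ¬ Collinear ℝ ({0, v, w} : Set R3)) :
    cr v w ≠ 0 := by
  intro hc
  apply h
  rw [collinear_iff_of_mem (p₀ := (0 : R3)) (by simp)]
  by_cases hv : v = 0
  · exact ⟨w, by
      rintro p (rfl | rfl | rfl)
      exacts [⟨0, by simp⟩, ⟨0, by simp [hv]⟩, ⟨1, by simp⟩]⟩
  · refine ⟨v, ?_⟩
    rintro p (rfl | rfl | rfl)
    · exact ⟨0, by simp⟩
    · exact ⟨1, by simp⟩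
    · refine ⟨inner ℝ v p / ‖v‖ ^ 2, ?_⟩
      have hn : ‖v‖ ^ 2 ≠ 0 := by simpa using hv
      have h0 : v 1 * p 2 - v 2 * p 1 = 0 := by rw [← cr_zero, hc]; rfl
      have h1 : v 2 * p 0 - v 0 * p 2 = 0 := by rw [← cr_one, hc]; rfl
      have h2 : v 0 * p 1 - v 1 * p 0 = 0 := by rw [← cr_two, hc]; rfl
      have key : ‖v‖ ^ 2 • p = inner ℝ v p • v := by
        rw [norm_sq_eq_coord, inner_eq_coord]
        apply ext3 <;> simp only [PiLp.smul_apply, smul_eq_mul]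
        · linear_combination v 2 * h1 - v 1 * h2
        · linear_combination v 0 * h2 - v 2 * h0
        · linear_combination v 1 * h0 - v 0 * h1
      rw [vadd_eq_add, add_zero, div_eq_inv_mul, mul_smul, ← key, smul_smul,
        inv_mul_cancel₀ hn, one_smul]

/-- Every nonzero vector has a companion that is not parallel to it. -/
theorem exists_cr_ne_zero {v : R3} (hv : v ≠ 0) : ∃ e : R3, cr v e ≠ 0 := by
  by_contra! H
  apply hv
  have hx := H !₂[1, 0, 0]
  have hy := H !₂[0, 1, 0]
  have e1 := congrArg (fun q : R3 => q 1) hx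
  have e2 := congrArg (fun q : R3 => q 2) hx
  have e3 := congrArg (fun q : R3 => q 2) hy
  simp at e1 e2 e3
  exact ext3 (by simpa using e3) (by simpa using e2) (by simpa using e1)

theorem isOpen_det3_ne (a b : R3) : IsOpen {p | det3 a b p ≠ 0} :=
  isOpen_ne_fun (continuous_det3 continuous_const continuous_const continuous_id) continuous_const

/-- The complement of a plane is dense. -/
theorem dense_det3_ne {a b : R3} (h : cr a b ≠ 0) : Dense {p | det3 a b p ≠ 0} := by
  intro p
  by_cases hp : det3 a b p = 0
  · have hc : Tendsto (fun t : ℝ => p + t • cr a b) (𝓝[≠] 0) (𝓝 p) := by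
      have : Continuous fun t : ℝ => p + t • cr a b := by fun_prop
      simpa using (this.tendsto 0).mono_left nhdsWithin_le_nhds
    refine mem_closure_of_tendsto hc ?_
    filter_upwards [self_mem_nhdsWithin] with t ht
    have := det3_comb a b p (cr a b) 1 t
    rw [one_smul, hp, det3_cr] at this
    rw [this]
    have : ‖cr a b‖ ≠ 0 := by simpa using h
    have ht : t ≠ 0 := ht
    rw [mul_zero, zero_add]
    positivity
  · exact subset_closure hp

theorem mem_cone_pair {v w p : R3} :
    p ∈ cone {v, w} ↔ ∃ s t : ℝ, 0 ≤ s ∧ 0 ≤ t ∧ p = s • v + t • w := by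
  unfold cone PointedCone.hull
  rw [SetLike.mem_coe, Submodule.mem_span_pair]
  constructor
  · rintro ⟨a, b, rfl⟩
    exact ⟨a, b, a.2, b.2, rfl⟩
  · rintro ⟨s, t, hs, ht, rfl⟩
    exact ⟨⟨s, hs⟩, ⟨t, ht⟩, rfl⟩

theorem mem_cone_singleton {v p : R3} : p ∈ cone {v} ↔ ∃ s : ℝ, 0 ≤ s ∧ p = s • v := by
  unfold cone PointedCone.hull
  rw [SetLike.mem_coe, Submodule.mem_span_singleton]
  constructor
  · rintro ⟨a, rfl⟩
    exact ⟨a, a.2, rfl⟩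
  · rintro ⟨s, hs, rfl⟩
    exact ⟨⟨s, hs⟩, rfl⟩

theorem mem_cone_empty {p : R3} : p ∈ cone ∅ ↔ p = 0 := by
  simp [cone, PointedCone.hull]

theorem smul_mem_cone {S : Set R3} {p : R3} (hp : p ∈ cone S) {t : ℝ} (ht : 0 ≤ t) :
    t • p ∈ cone S := (PointedCone.hull ℝ S).smul_mem ht hp

/-- The first coordinate of the projection of `p` to the plane of `v` and `w`, with respect to
the basis `(v, w)` and up to the positive factor `‖v × w‖ ^ 2`. -/
def coefA (v w p : R3) : ℝ := det3 p w (cr v w)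

/-- The second coordinate, see `coefA`. -/
def coefB (v w p : R3) : ℝ := det3 v p (cr v w)

/-- The expansion of `p` in the basis `(v, w, v × w)`. -/
theorem coef_expand (v w p : R3) :
    ‖cr v w‖ ^ 2 • p = coefA v w p • v + coefB v w p • w + det3 v w p • cr v w := by
  rw [← det3_cr]; exact cramer v w (cr v w) p

theorem coefA_comb (v w : R3) (s t : ℝ) : coefA v w (s • v + t • w) = s * ‖cr v w‖ ^ 2 := by
  rw [← det3_cr]
  simp only [coefA, det3_eq_coord, PiLp.add_apply, PiLp.smul_apply, smul_eq_mul]; ring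

theorem coefB_comb (v w : R3) (s t : ℝ) : coefB v w (s • v + t • w) = t * ‖cr v w‖ ^ 2 := by
  rw [← det3_cr]
  simp only [coefB, det3_eq_coord, PiLp.add_apply, PiLp.smul_apply, smul_eq_mul]; ring

theorem det3_comb_self (v w : R3) (s t : ℝ) : det3 v w (s • v + t • w) = 0 := by
  rw [det3_comb, det3_self_left, det3_self_right]; ring

theorem continuous_coefA (v w : R3) : Continuous (coefA v w) :=
  continuous_det3 continuous_id continuous_const continuous_const

theorem continuous_coefB (v w : R3) : Continuous (coefB v w) :=
  continuous_det3 continuous_const continuous_id continuous_const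

theorem eq_comb_of_det3_eq_zero {v w p : R3} (h : cr v w ≠ 0) (hp : det3 v w p = 0) :
    p = (coefA v w p / ‖cr v w‖ ^ 2) • v + (coefB v w p / ‖cr v w‖ ^ 2) • w := by
  have hn : ‖cr v w‖ ^ 2 ≠ 0 := by simpa using h
  have := coef_expand v w p
  rw [hp, zero_smul, add_zero] at this
  rw [div_eq_inv_mul, div_eq_inv_mul, mul_smul, mul_smul, ← smul_add, ← this, smul_smul,
    inv_mul_cancel₀ hn, one_smul]

theorem cone_pair_eq {v w : R3} (h : cr v w ≠ 0) :
    cone {v, w} = {p | det3 v w p = 0 ∧ 0 ≤ coefA v w p ∧ 0 ≤ coefB v w p} := by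
  ext p
  rw [mem_cone_pair]
  constructor
  · rintro ⟨s, t, hs, ht, rfl⟩
    refine ⟨det3_comb_self v w s t, ?_, ?_⟩
    · rw [coefA_comb]; positivity
    · rw [coefB_comb]; positivity
  · rintro ⟨h0, h1, h2⟩
    exact ⟨_, _, by positivity, by positivity, eq_comb_of_det3_eq_zero h h0⟩

theorem isClosed_cone_pair {v w : R3} (h : cr v w ≠ 0) : IsClosed (cone {v, w}) := by
  rw [cone_pair_eq h]
  refine (isClosed_eq (continuous_det3 continuous_const continuous_const continuous_id)
    continuous_const).inter ((isClosed_le continuous_const (continuous_coefA v w)).inter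
    (isClosed_le continuous_const (continuous_coefB v w)))

theorem cr_swap (v w : R3) : cr w v = -cr v w := by
  apply ext3 <;> simp <;> ring

theorem comb_unique {v w : R3} (h : cr v w ≠ 0) {s t s' t' : ℝ}
    (e : s • v + t • w = s' • v + t' • w) : s = s' ∧ t = t' := by
  have hn : ‖cr v w‖ ^ 2 ≠ 0 := by simpa using h
  have h1 := congrArg (coefA v w) e
  have h2 := congrArg (coefB v w) e
  rw [coefA_comb, coefA_comb] at h1
  rw [coefB_comb, coefB_comb] at h2
  exact ⟨mul_right_cancel₀ hn h1, mul_right_cancel₀ hn h2⟩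

/-- A function with values in a discrete set that is locally constant along a dense set `D` near
every point of a preconnected set `S` has the same local value at all points of `S`. -/
theorem exists_const_of_locally_const {α : Type*} {D S : Set R3} (hD : Dense D) (f : R3 → α)
    (hS : IsPreconnected S) (hne : S.Nonempty)
    (hf : ∀ x ∈ S, ∃ c, ∀ᶠ p in 𝓝[D] x, f p = c) :
    ∃ c, ∀ x ∈ S, ∀ᶠ p in 𝓝[D] x, f p = c := by
  classical
  obtain ⟨x0, hx0⟩ := hne
  obtain ⟨c0, hc0⟩ := hf x0 hx0
  refine ⟨c0, fun x hx => ?_⟩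
  -- The points with local value `c0`, and those with another local value, form disjoint open sets.
  let A : Set R3 := {x | ∀ᶠ p in 𝓝[D] x, f p = c0}
  let B : Set R3 := {x | ∃ c, c ≠ c0 ∧ ∀ᶠ p in 𝓝[D] x, f p = c}
  have hA : IsOpen A := by
    rw [isOpen_iff_mem_nhds]
    intro y hy
    have h' : ∀ᶠ p in 𝓝 y, p ∈ D → f p = c0 := eventually_nhdsWithin_iff.1 hy
    filter_upwards [eventually_eventually_nhds.2 h'] with z hz
    exact eventually_nhdsWithin_iff.2 hz
  have hB : IsOpen B := by
    rw [isOpen_iff_mem_nhds]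
    rintro y ⟨c, hc, hy⟩
    have h' : ∀ᶠ p in 𝓝 y, p ∈ D → f p = c := eventually_nhdsWithin_iff.1 hy
    filter_upwards [eventually_eventually_nhds.2 h'] with z hz
    exact ⟨c, hc, eventually_nhdsWithin_iff.2 hz⟩
  by_contra hxA
  have hsub : S ⊆ A ∪ B := by
    intro y hy
    obtain ⟨c, hc⟩ := hf y hy
    by_cases h : c = c0
    · subst h; exact Or.inl hc
    · exact Or.inr ⟨c, h, hc⟩
  have hxB : x ∈ B := (hsub hx).resolve_left hxA
  obtain ⟨y, -, hyA, c, hc, hyB⟩ := hS A B hA hB hsub ⟨x0, hx0, hc0⟩ ⟨x, hx, hxB⟩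
  have : (𝓝[D] y).NeBot := mem_closure_iff_nhdsWithin_neBot.1 (hD y)
  obtain ⟨p, hp1, hp2⟩ := ((show ∀ᶠ p in 𝓝[D] y, f p = c0 from hyA).and hyB).exists
  exact hc (hp2.symm.trans hp1)

/-! ### The parity function of an even set of edges -/

open Classical in
/-- The indicator, modulo two, of the open cone spanned by `a`, `b`, `c`, as a function of `p`.
It is written in terms of the signs of determinants (Cramer's rule), so that it vanishes when
`a`, `b`, `c` are linearly dependent. -/
def coneInd (a b c p : R3) : ZMod 2 :=
  if 0 < det3 a b c * det3 p b c ∧ 0 < det3 a b c * det3 a p c ∧ 0 < det3 a b c * det3 a b p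
  then 1 else 0

theorem exists_of_coneInd_ne_zero {a b c p : R3} (h : coneInd a b c p ≠ 0) :
    ∃ α β γ : ℝ, 0 < α ∧ 0 < β ∧ 0 < γ ∧ p = α • a + β • b + γ • c := by
  have hc : 0 < det3 a b c * det3 p b c ∧ 0 < det3 a b c * det3 a p c ∧
      0 < det3 a b c * det3 a b p := by
    by_contra hn
    exact h (if_neg hn)
  obtain ⟨h1, h2, h3⟩ := hc
  have hd : det3 a b c ≠ 0 := by
    rintro h0
    rw [h0, zero_mul] at h1
    exact lt_irrefl _ h1
  have hq : ∀ x : ℝ, 0 < det3 a b c * x → 0 < x / det3 a b c := fun x hx => by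
    have : x / det3 a b c = det3 a b c * x / (det3 a b c) ^ 2 := by field_simp
    rw [this]; positivity
  refine ⟨_, _, _, hq _ h1, hq _ h2, hq _ h3, ?_⟩
  simp only [div_eq_inv_mul, mul_smul, ← smul_add]
  rw [← cramer, smul_smul, inv_mul_cancel₀ hd, one_smul]

set_option synthInstance.maxSize 4096 in
set_option synthInstance.maxHeartbeats 400000 in
set_option maxRecDepth 100000 in
/-- The sign patterns of the ten determinants of five vectors in general position satisfy the
cocycle relation for the indicators of simplicial cones. The hypotheses are the sign conditions
imposed by the three-term Grassmann–Plücker relations. -/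
theorem sign_cocycle : ∀ pab pac pad pbc pbd pcd abc abd acd bcd : Bool,
    ¬ ((pab == pcd) = (pac != pbd) ∧ (pab == pcd) = (pad == pbc)) →
    ¬ ((pab == acd) = (pac != abd) ∧ (pab == acd) = (pad == abc)) →
    ¬ ((pab == bcd) = (pbc != abd) ∧ (pab == bcd) = (pbd == abc)) →
    ¬ ((pac == bcd) = (pbc != acd) ∧ (pac == bcd) = (pcd == abc)) →
    ¬ ((pad == bcd) = (pbd != acd) ∧ (pad == bcd) = (pcd == abd)) →
    (((pbc == abc) && (pac != abc) && (pab == abc)) ^^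
      ((pbd == abd) && (pad != abd) && (pab == abd)) ^^
      ((pcd == acd) && (pad != acd) && (pac == acd)) ^^
      ((pcd == bcd) && (pbd != bcd) && (pbc == bcd))) =
    ((bcd != acd) && (acd != abd) && (abd != abc)) := by
  decide

theorem decide_pos_mul {x y : ℝ} (hx : x ≠ 0) (hy : y ≠ 0) :
    decide (0 < x * y) = (decide (0 < x) == decide (0 < y)) := by
  rcases hx.lt_or_gt with h1 | h1 <;> rcases hy.lt_or_gt with h2 | h2
  · simp [mul_pos_of_neg_of_neg h1 h2, h1.not_gt, h2.not_gt]
  · simp [(mul_neg_of_neg_of_pos h1 h2).not_gt, h1.not_gt, h2]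
  · simp [(mul_neg_of_pos_of_neg h1 h2).not_gt, h1, h2.not_gt]
  · simp [mul_pos h1 h2, h1, h2]

theorem decide_pos_neg {x : ℝ} (hx : x ≠ 0) : decide (0 < -x) = !decide (0 < x) := by
  rcases hx.lt_or_gt with h1 | h1
  · simp [h1, h1.not_gt]
  · simp [h1, h1.le]

/-- Three nonzero terms whose sum vanishes do not all have the same sign. -/
theorem sign_relation {x y z u v w : ℝ} (hx : x ≠ 0) (hy : y ≠ 0) (hz : z ≠ 0) (hu : u ≠ 0)
    (hv : v ≠ 0) (hw : w ≠ 0) (h : x * y - z * u + v * w = 0) :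
    ¬ ((decide (0 < x) == decide (0 < y)) = (decide (0 < z) != decide (0 < u)) ∧
      (decide (0 < x) == decide (0 < y)) = (decide (0 < v) == decide (0 < w))) := by
  rw [bne, ← decide_pos_mul hx hy, ← decide_pos_mul hz hu, ← decide_pos_mul hv hw,
    ← decide_pos_neg (mul_ne_zero hz hu)]
  rintro ⟨h1, h2⟩
  have hxy := mul_ne_zero hx hy
  have hzu := mul_ne_zero hz hu
  have hvw := mul_ne_zero hv hw
  rw [decide_eq_decide] at h1 h2
  rcases hxy.lt_or_gt with h3 | h3
  · have e1 : ¬ 0 < -(z * u) := fun h' => h3.not_gt (h1.2 h')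
    have e2 : ¬ 0 < v * w := fun h' => h3.not_gt (h2.2 h')
    linarith [not_lt.1 e1, not_lt.1 e2]
  · linarith [h1.1 h3, h2.1 h3]

theorem coneInd_eq_ite {a b c p : R3} (h : det3 a b c ≠ 0) (h1 : det3 p b c ≠ 0)
    (h2 : det3 p a c ≠ 0) (h3 : det3 p a b ≠ 0) :
    coneInd a b c p = if ((decide (0 < det3 p b c) == decide (0 < det3 a b c)) &&
      (decide (0 < det3 p a c) != decide (0 < det3 a b c)) &&
      (decide (0 < det3 p a b) == decide (0 < det3 a b c))) = true then 1 else 0 := by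
  have e2 : det3 a p c = -det3 p a c := det3_swap _ _ _
  have e3 : det3 a b p = det3 p a b := det3_rot _ _ _
  unfold coneInd
  rw [e2, e3]
  congr 1
  rw [bne, ← decide_pos_mul h1 h, ← decide_pos_mul h2 h, ← decide_pos_mul h3 h,
    ← decide_pos_neg (mul_ne_zero h2 h)]
  simp only [Bool.and_eq_true, decide_eq_true_eq, and_assoc, eq_iff_iff]
  rw [mul_comm (det3 p b c), mul_comm (det3 p a b), mul_neg, mul_comm (det3 p a c)]

theorem ite_xor4 (b1 b2 b3 b4 : Bool) :
    (if b1 = true then (1 : ZMod 2) else 0) + (if b2 = true then 1 else 0) +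
      (if b3 = true then 1 else 0) + (if b4 = true then 1 else 0) =
    if (b1 ^^ b2 ^^ b3 ^^ b4) = true then 1 else 0 := by
  revert b1 b2 b3 b4; decide

open Classical in
/-- The number, modulo two, of the four simplicial cones spanned by three of the vectors `a`,
`b`, `c`, `d` that contain a general point: it is `1` exactly if the origin is interior to the
simplex with vertices `a`, `b`, `c`, `d`. -/
def simplexParity (a b c d : R3) : ZMod 2 :=
  if ((decide (0 < det3 b c d) != decide (0 < det3 a c d)) &&
    (decide (0 < det3 a c d) != decide (0 < det3 a b d)) &&
    (decide (0 < det3 a b d) != decide (0 < det3 a b c))) = true then 1 else 0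

/-- The indicators of simplicial cones form a cocycle up to a constant: the sum over the faces of
a simplex does not depend on the point at which it is taken. -/
theorem coneInd_cocycle {a b c d p : R3} (habc : det3 a b c ≠ 0) (habd : det3 a b d ≠ 0)
    (hacd : det3 a c d ≠ 0) (hbcd : det3 b c d ≠ 0) (hpab : det3 p a b ≠ 0)
    (hpac : det3 p a c ≠ 0) (hpad : det3 p a d ≠ 0) (hpbc : det3 p b c ≠ 0)
    (hpbd : det3 p b d ≠ 0) (hpcd : det3 p c d ≠ 0) :
    coneInd a b c p + coneInd a b d p + coneInd a c d p + coneInd b c d p =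
      simplexParity a b c d := by
  rw [coneInd_eq_ite habc hpbc hpac hpab, coneInd_eq_ite habd hpbd hpad hpab,
    coneInd_eq_ite hacd hpcd hpad hpac, coneInd_eq_ite hbcd hpcd hpbd hpbc, ite_xor4]
  unfold simplexParity
  congr 2
  refine sign_cocycle _ _ _ _ _ _ _ _ _ _
    (sign_relation hpab hpcd hpac hpbd hpad hpbc ?_)
    (sign_relation hpab hacd hpac habd hpad habc ?_)
    (sign_relation hpab hbcd hpbc habd hpbd habc ?_)
    (sign_relation hpac hbcd hpbc hacd hpcd habc ?_)
    (sign_relation hpad hbcd hpbd hacd hpcd habd ?_) <;>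
  · simp only [det3_eq_coord]; ring

/-- The cone from `o` over an arc does not come near a point `x` off the arc when `o` is close to
the antipode of `x`. -/
theorem coneInd_eq_zero_of_ball {a b o x p : R3} {r : ℝ}
    (hd : ∀ q ∈ Metric.ball x r, q ∉ cone {a, b}) (ho : -o ∈ Metric.ball x r)
    (hp : p ∈ Metric.ball x r) : coneInd a b o p = 0 := by
  by_contra h
  obtain ⟨α, β, γ, hα, hβ, hγ, e⟩ := exists_of_coneInd_ne_zero h
  -- A convex combination of `p` and `-o` lies both in the ball and in the cone over the arc.
  have hm := (convex_ball x r) hp ho (a := 1 / (1 + γ)) (b := γ / (1 + γ)) (by positivity)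
    (by positivity) (by field_simp)
  refine hd _ hm (mem_cone_pair.2 ⟨α / (1 + γ), β / (1 + γ), by positivity, by positivity, ?_⟩)
  rw [e]
  apply ext3 <;> simp only [PiLp.add_apply, PiLp.smul_apply, PiLp.neg_apply, smul_eq_mul] <;>
  · field_simp; ring

/-- Near a point `x` of the open arc spanned by `a` and `b`, the cone from `o` over the arc is the
side of the arc on which `o` lies, when `o` is close to the antipode of `x`. -/
theorem coneInd_eq_ite_of_ball {a b o x p : R3} {r : ℝ}
    (hd : ∀ q ∈ Metric.ball x r, 0 < coefA a b q ∧ 0 < coefB a b q)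
    (ho : -o ∈ Metric.ball x r) (hp : p ∈ Metric.ball x r) (hab : det3 a b o ≠ 0) :
    coneInd a b o p = if 0 < det3 a b o * det3 a b p then 1 else 0 := by
  have hcr : cr a b ≠ 0 := by
    intro h
    have := (hd _ hp).1
    rw [coefA, h] at this
    simp [det3_eq_coord] at this
  unfold coneInd
  congr 1
  rw [eq_iff_iff]
  refine ⟨fun h => h.2.2, fun h => ⟨?_, ?_, h⟩⟩
  all_goals
    set D := det3 a b o with hD
    set γ := det3 a b p / D with hγ
    have hγ0 : 0 < γ := by
      have : γ = D * det3 a b p / D ^ 2 := by rw [hγ]; field_simp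
      rw [this]; positivity
    -- The point of the plane of the arc on the segment from `p` to `-o` stays in the ball.
    have hm := (convex_ball x r) hp ho (a := 1 / (1 + γ)) (b := γ / (1 + γ)) (by positivity)
      (by positivity) (by field_simp)
    have hcram := cramer a b o p
    have e : (1 / (1 + γ)) • p + (γ / (1 + γ)) • -o =
        (det3 p b o / (D * (1 + γ))) • a + (det3 a p o / (D * (1 + γ))) • b := by
      have h0 := congrArg (fun q : R3 => q 0) hcram
      have h1 := congrArg (fun q : R3 => q 1) hcram
      have h2 := congrArg (fun q : R3 => q 2) hcram
      simp only [PiLp.add_apply, PiLp.smul_apply, smul_eq_mul, ← hD] at h0 h1 h2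
      have hg : γ * D = det3 a b p := by rw [hγ]; field_simp
      have hg1 : (1 + γ) ≠ 0 := by positivity
      apply ext3 <;> simp only [PiLp.add_apply, PiLp.smul_apply, PiLp.neg_apply, smul_eq_mul] <;>
        field_simp
      · linear_combination h0 - o 0 * hg
      · linear_combination h1 - o 1 * hg
      · linear_combination h2 - o 2 * hg
    have hpos := hd _ hm
    rw [e, coefA_comb, coefB_comb] at hpos
    have hN : 0 < ‖cr a b‖ ^ 2 := by positivity
  · have := pos_of_mul_pos_left hpos.1 hN.le
    have h2 : D * det3 p b o = det3 p b o / (D * (1 + γ)) * (D ^ 2 * (1 + γ)) := by field_simp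
    rw [h2]; positivity
  · have := pos_of_mul_pos_left hpos.2 hN.le
    have h2 : D * det3 a p o = det3 a p o / (D * (1 + γ)) * (D ^ 2 * (1 + γ)) := by field_simp
    rw [h2]; positivity

theorem eventually_pos_iff {X : Type*} [TopologicalSpace X] {h : X → ℝ} (hc : Continuous h)
    {p : X} (hp : h p ≠ 0) : ∀ᶠ q in 𝓝 p, (0 < h q ↔ 0 < h p) := by
  rcases hp.lt_or_gt with h1 | h1
  · filter_upwards [hc.continuousAt.eventually_lt_const h1] with q hq
    exact ⟨fun h' => absurd h' hq.not_gt, fun h' => absurd h' h1.not_gt⟩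
  · filter_upwards [hc.continuousAt.eventually_const_lt h1] with q hq
    exact ⟨fun _ => h1, fun _ => hq⟩

theorem coneInd_eventually_eq {a b c p : R3} (h : det3 a b c ≠ 0) (h1 : det3 p b c ≠ 0)
    (h2 : det3 a p c ≠ 0) (h3 : det3 a b p ≠ 0) :
    ∀ᶠ q in 𝓝 p, coneInd a b c q = coneInd a b c p := by
  have c1 : Continuous fun q => det3 a b c * det3 q b c :=
    continuous_const.mul (continuous_det3 continuous_id continuous_const continuous_const)
  have c2 : Continuous fun q => det3 a b c * det3 a q c :=
    continuous_const.mul (continuous_det3 continuous_const continuous_id continuous_const)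
  have c3 : Continuous fun q => det3 a b c * det3 a b q :=
    continuous_const.mul (continuous_det3 continuous_const continuous_const continuous_id)
  filter_upwards [eventually_pos_iff c1 (mul_ne_zero h h1),
    eventually_pos_iff c2 (mul_ne_zero h h2),
    eventually_pos_iff c3 (mul_ne_zero h h3)] with q h1 h2 h3
  unfold coneInd
  simp only [h1, h2, h3]

/-- The complement of finitely many planes is open and dense. -/
theorem isOpen_dense_of_finite {ι : Type*} [Finite ι] (a b : ι → R3)
    (h : ∀ i, cr (a i) (b i) ≠ 0) :
    IsOpen {p | ∀ i, det3 (a i) (b i) p ≠ 0} ∧ Dense {p | ∀ i, det3 (a i) (b i) p ≠ 0} := by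
  have e : {p | ∀ i, det3 (a i) (b i) p ≠ 0} = ⋂ i, {p | det3 (a i) (b i) p ≠ 0} := by
    ext p; simp
  rw [e]
  exact ⟨isOpen_iInter_of_finite fun i => isOpen_det3_ne _ _,
    dense_iInter_of_isOpen (fun i => isOpen_det3_ne _ _) fun i => dense_det3_ne (h i)⟩

theorem cr_ne_zero_left {a b o : R3} (h : det3 a b o ≠ 0) : cr a o ≠ 0 := by
  intro hc
  apply h
  have h0 : a 1 * o 2 - a 2 * o 1 = 0 := by rw [← cr_zero, hc]; rfl
  have h1 : a 2 * o 0 - a 0 * o 2 = 0 := by rw [← cr_one, hc]; rfl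
  have h2 : a 0 * o 1 - a 1 * o 0 = 0 := by rw [← cr_two, hc]; rfl
  rw [det3_eq_coord]
  linear_combination -b 0 * h0 - b 1 * h1 - b 2 * h2

theorem cr_ne_zero_of_det3 {a b o : R3} (h : det3 a b o ≠ 0) : cr a b ≠ 0 :=
  cr_ne_zero_left (b := o) (by rw [det3_swap']; simpa using h)

section Parity

variable {ι : Type*} [Fintype ι] (a b : ι → R3) (z : ι → ZMod 2)

/-- The sum of the indicators of the cones from `o` over the arcs from `a i` to `b i`, with
coefficients `z i`. -/
def parity (o p : R3) : ZMod 2 := ∑ i, z i * coneInd (a i) (b i) o p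

/-- The points in general position with respect to the arcs and the point `o`. -/
def generic (o : R3) : Set R3 :=
  {p | ∀ i, det3 (a i) (b i) p ≠ 0} ∩ {p | ∀ i, det3 (a i) o p ≠ 0} ∩
    {p | ∀ i, det3 (b i) o p ≠ 0}

variable {a b z}

theorem isOpen_dense_generic {o : R3} (ho : ∀ i, det3 (a i) (b i) o ≠ 0) :
    IsOpen (generic a b o) ∧ Dense (generic a b o) := by
  have h1 := isOpen_dense_of_finite a b fun i => cr_ne_zero_of_det3 (ho i)
  have h2 := isOpen_dense_of_finite a (fun _ => o) fun i => cr_ne_zero_left (ho i)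
  have h3 := isOpen_dense_of_finite b (fun _ => o) fun i => cr_ne_zero_left (a := b i) (b := a i)
    (by rw [det3_swap]; simpa using ho i)
  exact ⟨(h1.1.inter h2.1).inter h3.1,
    (h1.2.inter_of_isOpen_right h2.2 h2.1).inter_of_isOpen_right h3.2 h3.1⟩

/-- Up to a constant, the parity function of an even set of arcs does not depend on the point
from which the arcs are coned off: the side faces in the cocycle relation cancel at each node. -/
theorem parity_add_parity (hz : ∀ f : R3 → ZMod 2, ∑ i, z i * (f (a i) + f (b i)) = 0)
    {o o' p : R3} (ho : ∀ i, det3 (a i) (b i) o ≠ 0) (ho' : o' ∈ generic a b o)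
    (hp : p ∈ generic a b o) (hp' : p ∈ generic a b o') (hpo : ∀ _ : ι, det3 o o' p ≠ 0) :
    parity a b z o p = (∑ i, z i * simplexParity (a i) (b i) o o') + parity a b z o' p := by
  have key : ∀ i, z i * coneInd (a i) (b i) o p = z i * simplexParity (a i) (b i) o o' +
      z i * coneInd (a i) (b i) o' p +
      z i * (coneInd (a i) o o' p + coneInd (b i) o o' p) := by
    intro i
    have := coneInd_cocycle (p := p) (ho i) (ho'.1.1 i) (ho'.1.2 i) (ho'.2 i)
      (by rw [← det3_rot]; exact hp.1.1 i) (by rw [← det3_rot]; exact hp.1.2 i)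
      (by rw [← det3_rot]; exact hp'.1.2 i) (by rw [← det3_rot]; exact hp.2 i)
      (by rw [← det3_rot]; exact hp'.2 i) (by rw [← det3_rot]; exact hpo i)
    rw [← this]
    have h2 : ∀ x : ZMod 2, x + x = 0 := CharTwo.add_self_eq_zero
    linear_combination -z i * h2 (coneInd (a i) (b i) o' p) - z i * h2 (coneInd (a i) o o' p) -
      z i * h2 (coneInd (b i) o o' p)
  unfold parity
  rw [Finset.sum_congr rfl fun i _ => key i, Finset.sum_add_distrib, Finset.sum_add_distrib,
    hz fun q => coneInd q o o' p, add_zero]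

/-- For a ball and an apex `o'` close to the antipode of its center, the parity function from `o`
can be computed from `o'`, at a nearby point on the same side of all arcs. -/
theorem exists_parity_eq (hz : ∀ f : R3 → ZMod 2, ∑ i, z i * (f (a i) + f (b i)) = 0)
    {o : R3} (ho : ∀ i, det3 (a i) (b i) o ≠ 0) (x : R3) {r : ℝ} (hr : 0 < r) :
    ∃ (K : ZMod 2) (o' : R3), -o' ∈ Metric.ball x r ∧ (∀ i, det3 (a i) (b i) o' ≠ 0) ∧
      ∀ p ∈ Metric.ball x r, p ∈ generic a b o → ∃ p' ∈ Metric.ball x r,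
        parity a b z o p = K + parity a b z o' p' ∧
        ∀ i, det3 (a i) (b i) p' ≠ 0 ∧ (0 < det3 (a i) (b i) p' ↔ 0 < det3 (a i) (b i) p) := by
  obtain ⟨hgo, hgd⟩ := isOpen_dense_generic ho
  obtain ⟨o', ho'g, ho'b⟩ := hgd.inter_nhds_nonempty (Metric.ball_mem_nhds (-x) hr)
  refine ⟨∑ i, z i * simplexParity (a i) (b i) o o', o', ?_, ho'g.1.1, ?_⟩
  · rw [mem_ball_iff_norm] at ho'b ⊢
    rwa [show -o' - x = -(o' - -x) by rw [neg_sub]; abel, norm_neg]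
  intro p hp hpg
  have hg' := isOpen_dense_generic (a := a) (b := b) (o := o') ho'g.1.1
  have hoo := isOpen_dense_of_finite (fun _ : ι => o) (fun _ => o') fun i =>
    cr_ne_zero_left (b := a i) (by rw [det3_swap]; simpa using ho'g.1.2 i)
  have hd := hg'.2.inter_of_isOpen_right hoo.2 hoo.1
  have hev : ∀ᶠ q in 𝓝 p, q ∈ Metric.ball x r ∧ q ∈ generic a b o ∧
      (∀ i, coneInd (a i) (b i) o q = coneInd (a i) (b i) o p) ∧
      ∀ i, (0 < det3 (a i) (b i) q ↔ 0 < det3 (a i) (b i) p) := by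
    refine (Metric.isOpen_ball.eventually_mem hp).and ((hgo.eventually_mem hpg).and
      ((eventually_all.2 fun i => ?_).and (eventually_all.2 fun i => ?_)))
    · refine coneInd_eventually_eq (ho i) ?_ ?_ (hpg.1.1 i)
      · rw [← det3_rot]; exact hpg.2 i
      · rw [det3_swap']; simpa using hpg.1.2 i
    · exact eventually_pos_iff (continuous_det3 continuous_const continuous_const continuous_id)
        (hpg.1.1 i)
  -- `p` need not be in general position with respect to `o'`, but a nearby point is.
  obtain ⟨p', ⟨hp1, hp2⟩, hb, hpg', hc, hs⟩ := hd.inter_nhds_nonempty hev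
  refine ⟨p', hb, ?_, fun i => ⟨hpg'.1.1 i, hs i⟩⟩
  rw [← parity_add_parity hz ho ho'g hpg' hp1 hp2]
  exact Finset.sum_congr rfl fun i _ => by rw [hc i]

/-- The Jordan curve theorem modulo two for an even set of geodesic arcs: there is a function
that is locally constant off the arcs, and jumps across each arc. To avoid a discussion of special
positions, it is considered on a dense set only. The hypothesis `hz` says that the coefficients
`z i` at each node add up to zero. -/
theorem exists_parity_function (hab : ∀ i, cr (a i) (b i) ≠ 0)
    (hz : ∀ f : R3 → ZMod 2, ∑ i, z i * (f (a i) + f (b i)) = 0) :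
    ∃ (f : R3 → ZMod 2) (D : Set R3), Dense D ∧
      (∀ x, (∀ i, z i ≠ 0 → x ∉ cone {a i, b i}) → ∃ c, ∀ᶠ p in 𝓝[D] x, f p = c) ∧
      (∀ i x, z i ≠ 0 → (∃ s t : ℝ, 0 < s ∧ 0 < t ∧ x = s • a i + t • b i) →
        (∀ j, j ≠ i → z j ≠ 0 → x ∉ cone {a j, b j}) → ∃ c,
          (∀ᶠ p in 𝓝[D] x, 0 < det3 (a i) (b i) p → f p = c + 1) ∧
          (∀ᶠ p in 𝓝[D] x, det3 (a i) (b i) p < 0 → f p = c)) := by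
  classical
  obtain ⟨o, ho⟩ := (isOpen_dense_of_finite a b hab).2.nonempty
  have ho : ∀ i, det3 (a i) (b i) o ≠ 0 := ho
  have hball : ∀ (x : R3) (P : ι → Prop), (∀ j, P j → x ∉ cone {a j, b j}) →
      ∀ᶠ q in 𝓝 x, ∀ j, P j → q ∉ cone {a j, b j} := by
    intro x P hP
    refine eventually_all.2 fun j => ?_
    by_cases hj : P j
    · filter_upwards [(isClosed_cone_pair (hab j)).isOpen_compl.eventually_mem (hP j hj)]
        with q hq _ using hq
    · exact Eventually.of_forall fun q h => absurd h hj
  refine ⟨parity a b z o, generic a b o, (isOpen_dense_generic ho).2, ?_, ?_⟩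
  · intro x hx
    obtain ⟨r, hr, hb⟩ := Metric.eventually_nhds_iff_ball.1 (hball x _ hx)
    obtain ⟨K, o', ho'b, -, hK⟩ := exists_parity_eq hz ho x hr
    refine ⟨K, ?_⟩
    rw [eventually_nhdsWithin_iff]
    filter_upwards [Metric.ball_mem_nhds x hr] with p hp hpg
    obtain ⟨p', hp', e, -⟩ := hK p hp hpg
    rw [e]
    convert add_zero K
    refine Finset.sum_eq_zero fun i _ => ?_
    by_cases hi : z i = 0
    · rw [hi, zero_mul]
    · rw [coneInd_eq_zero_of_ball (fun q hq => hb q hq i hi) ho'b hp', mul_zero]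
  · rintro i x hzi ⟨s, t, hs, ht, hx⟩ hj
    have hN : 0 < ‖cr (a i) (b i)‖ ^ 2 := by have := hab i; positivity
    have hA : 0 < coefA (a i) (b i) x := by rw [hx, coefA_comb]; positivity
    have hB : 0 < coefB (a i) (b i) x := by rw [hx, coefB_comb]; positivity
    obtain ⟨r, hr, hb⟩ := Metric.eventually_nhds_iff_ball.1
      ((hball x (fun j => j ≠ i ∧ z j ≠ 0) fun j h => hj j h.1 h.2).and
      (((continuous_coefA (a i) (b i)).continuousAt.eventually_const_lt hA).and
      ((continuous_coefB (a i) (b i)).continuousAt.eventually_const_lt hB)))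
    obtain ⟨K, o', ho'b, ho', hK⟩ := exists_parity_eq hz ho x hr
    have hz1 : z i = 1 := by
      generalize z i = y at hzi
      revert y; decide
    have hval : ∀ p ∈ Metric.ball x r, p ∈ generic a b o → parity a b z o p =
        K + if 0 < det3 (a i) (b i) o' * det3 (a i) (b i) p then 1 else 0 := by
      intro p hp hpg
      obtain ⟨p', hp', e, hs⟩ := hK p hp hpg
      rw [e]
      congr 1
      unfold parity
      rw [Finset.sum_eq_single i, hz1, one_mul,
        coneInd_eq_ite_of_ball (fun q hq => (hb q hq).2) ho'b hp' (ho' i)]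
      · congr 1
        rw [eq_iff_iff, ← decide_eq_decide, decide_pos_mul (ho' i) (hs i).1, decide_pos_mul (ho' i)
          (hpg.1.1 i), decide_eq_decide.2 (hs i).2]
      · intro j _ hji
        by_cases hzj : z j = 0
        · rw [hzj, zero_mul]
        · rw [coneInd_eq_zero_of_ball (fun q hq => (hb q hq).1 j ⟨hji, hzj⟩) ho'b hp', mul_zero]
      · intro h; exact absurd (Finset.mem_univ i) h
    -- The values on the two sides depend on the side on which the apex `o'` lies.
    have hnear : ∀ᶠ p in 𝓝[generic a b o] x, p ∈ Metric.ball x r ∧ p ∈ generic a b o := by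
      rw [eventually_nhdsWithin_iff]
      filter_upwards [Metric.ball_mem_nhds x hr] with p hp hpg using ⟨hp, hpg⟩
    rcases (ho' i).lt_or_gt with hneg | hpos
    · refine ⟨K + 1, ?_, ?_⟩
      · filter_upwards [hnear] with p hp hd
        rw [hval p hp.1 hp.2, if_neg (mul_neg_of_neg_of_pos hneg hd).not_gt, add_zero, add_assoc,
          CharTwo.add_self_eq_zero, add_zero]
      · filter_upwards [hnear] with p hp hd
        rw [hval p hp.1 hp.2, if_pos (mul_pos_of_neg_of_neg hneg hd)]
    · refine ⟨K, ?_, ?_⟩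
      · filter_upwards [hnear] with p hp hd
        rw [hval p hp.1 hp.2, if_pos (mul_pos hpos hd)]
      · filter_upwards [hnear] with p hp hd
        rw [hval p hp.1 hp.2, if_neg (mul_neg_of_pos_of_neg hpos hd).not_gt, add_zero]

end Parity

/-! ### Azimuth angles -/

/-- The complex number whose argument is the azimuth angle: the product of the projection of `p`
and the conjugate of the projection of `u`, in the plane orthogonal to `v`. It vanishes if `p` lies
on the axis, in which case the azimuth is `0`. -/
def zc (v u p : R3) : ℂ :=
  ⟨inner ℝ u p - inner ℝ u v * inner ℝ p v / ‖v‖ ^ 2, det3 v u p / ‖v‖⟩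

theorem azim_eq_zc (v u p : R3) :
    azim v u p = toIcoMod Real.two_pi_pos 0 (Complex.arg (zc v u p)) := rfl

/-- The squared length of the projection of `w` to the plane orthogonal to `v`. -/
def rho (v w : R3) : ℝ := ‖cr v w‖ ^ 2 / ‖v‖ ^ 2

theorem norm_pos_of_cr {v w : R3} (h : cr v w ≠ 0) : 0 < ‖v‖ := by
  rw [norm_pos_iff]
  rintro rfl
  apply h
  apply ext3 <;> simp

theorem rho_pos {v w : R3} (h : cr v w ≠ 0) : 0 < rho v w := by
  have := norm_pos_of_cr h
  unfold rho; positivity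

/-- Multiplicativity, which makes azimuth angles additive modulo `2π`. -/
theorem zc_mul {v : R3} (hv : 0 < ‖v‖) (u w p : R3) :
    zc v u w * zc v w p = (rho v w : ℂ) * zc v u p := by
  have hN := norm_sq_eq_coord v
  have hne : ‖v‖ ≠ 0 := hv.ne'
  have hC := norm_sq_eq_coord (cr v w)
  simp only [cr_zero, cr_one, cr_two] at hC
  have h4 : ‖v‖ ^ 4 = (v 0 ^ 2 + v 1 ^ 2 + v 2 ^ 2) ^ 2 := by rw [← hN]; ring
  apply Complex.ext
  · simp only [zc, rho, Complex.mul_re, Complex.ofReal_re, Complex.ofReal_im, hC]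
    simp only [inner_eq_coord, det3_eq_coord]
    field_simp
    rw [hN]
    ring
  · simp only [zc, rho, Complex.mul_im, Complex.ofReal_re, Complex.ofReal_im, hC]
    simp only [inner_eq_coord, det3_eq_coord]
    field_simp
    rw [hN]
    ring

theorem zc_comb (v u p q : R3) (s t : ℝ) :
    zc v u (s • p + t • q) = s * zc v u p + t * zc v u q := by
  apply Complex.ext
  · simp only [zc, Complex.add_re, Complex.mul_re, Complex.ofReal_re, Complex.ofReal_im,
      inner_add_left, inner_add_right, real_inner_smul_left, real_inner_smul_right]
    ring
  · simp only [zc, Complex.add_im, Complex.mul_im, Complex.ofReal_re, Complex.ofReal_im, det3_comb]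
    ring

theorem zc_axis {v : R3} (hv : 0 < ‖v‖) (u : R3) : zc v u v = 0 := by
  have hne : ‖v‖ ^ 2 ≠ 0 := by positivity
  apply Complex.ext
  · simp [zc, hv.ne']
  · simp [zc, det3_self_left]

theorem zc_self {v : R3} (hv : 0 < ‖v‖) (w : R3) : zc v w w = rho v w := by
  have hN := norm_sq_eq_coord v
  have hne : ‖v‖ ≠ 0 := hv.ne'
  have hC := norm_sq_eq_coord (cr v w)
  simp only [cr_zero, cr_one, cr_two] at hC
  apply Complex.ext
  · simp only [zc, rho, Complex.ofReal_re, hC, inner_eq_coord]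
    field_simp
    rw [hN]; ring
  · simp [zc, det3_self_right]

theorem zc_cr (v w : R3) : zc v w (cr v w) = (‖cr v w‖ ^ 2 / ‖v‖ : ℝ) * Complex.I := by
  have h1 : inner ℝ w (cr v w) = 0 := by
    simp only [inner_eq_coord, cr_zero, cr_one, cr_two]; ring
  have h2 : inner ℝ (cr v w) v = 0 := by
    simp only [inner_eq_coord, cr_zero, cr_one, cr_two]; ring
  apply Complex.ext
  · rw [Complex.re_ofReal_mul, Complex.I_re, zc, h1, h2]; simp
  · rw [Complex.im_ofReal_mul, Complex.I_im, zc, det3_cr, mul_one]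

theorem zc_ne_zero {v u p : R3} (hu : cr v u ≠ 0) (hp : cr v p ≠ 0) : zc v u p ≠ 0 := by
  have hv := norm_pos_of_cr hu
  intro h
  have := zc_mul hv u p u
  rw [h, zero_mul, zc_self hv, ← Complex.ofReal_mul, eq_comm, Complex.ofReal_eq_zero] at this
  exact (mul_pos (rho_pos hp) (rho_pos hu)).ne' this

theorem azim_nonneg (v u p : R3) : 0 ≤ azim v u p := (toIcoMod_mem_Ico _ _ _).1

theorem azim_lt (v u p : R3) : azim v u p < 2 * Real.pi := by
  have := (toIcoMod_mem_Ico Real.two_pi_pos 0 (Complex.arg (zc v u p))).2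
  rwa [zero_add] at this

theorem zc_polar (v u p : R3) :
    zc v u p = ‖zc v u p‖ * Complex.exp (azim v u p * Complex.I) := by
  conv_lhs => rw [← Complex.norm_mul_exp_arg_mul_I (zc v u p)]
  congr 1
  rw [Complex.exp_eq_exp_iff_exists_int]
  refine ⟨toIcoDiv Real.two_pi_pos 0 (Complex.arg (zc v u p)), ?_⟩
  rw [azim_eq_zc, ← self_sub_toIcoDiv_zsmul Real.two_pi_pos 0 (Complex.arg (zc v u p))]
  simp only [zsmul_eq_mul]
  push_cast
  ring

theorem azim_eq_of_polar {v u p : R3} {r φ : ℝ} (hr : 0 < r) (h0 : 0 ≤ φ) (h1 : φ < 2 * Real.pi)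
    (h : zc v u p = r * Complex.exp (φ * Complex.I)) : azim v u p = φ := by
  rw [azim_eq_zc, h, Complex.arg_real_mul _ hr, Complex.arg_exp_mul_I, toIcoMod_toIocMod,
    toIcoMod_eq_self, zero_add]
  exact ⟨h0, h1⟩

theorem azim_self {v w : R3} (h : cr v w ≠ 0) : azim v w w = 0 := by
  refine azim_eq_of_polar (rho_pos h) le_rfl Real.two_pi_pos ?_
  rw [zc_self (norm_pos_of_cr h)]; simp

theorem zc_add_polar {v u w p : R3} (hu : cr v u ≠ 0) (hw : cr v w ≠ 0) (hp : cr v p ≠ 0) :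
    ∃ r : ℝ, 0 < r ∧
      zc v u p = r * Complex.exp ((azim v u w + azim v w p : ℝ) * Complex.I) := by
  refine ⟨‖zc v u w‖ * ‖zc v w p‖ / rho v w, ?_, ?_⟩
  · have h1 := norm_pos_iff.2 (zc_ne_zero hu hw)
    have h2 := norm_pos_iff.2 (zc_ne_zero hw hp)
    have h3 := rho_pos hw
    positivity
  · have h3 : (rho v w : ℂ) ≠ 0 := by exact_mod_cast (rho_pos hw).ne'
    have := zc_mul (norm_pos_of_cr hu) u w p
    rw [zc_polar v u w, zc_polar v w p] at this
    rw [← mul_right_inj' h3, ← this]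
    push_cast
    rw [add_mul, Complex.exp_add]
    field_simp

theorem azim_add_of_lt {v u w p : R3} (hu : cr v u ≠ 0) (hw : cr v w ≠ 0) (hp : cr v p ≠ 0)
    (h : azim v u w + azim v w p < 2 * Real.pi) :
    azim v u p = azim v u w + azim v w p := by
  obtain ⟨r, hr, e⟩ := zc_add_polar hu hw hp
  exact azim_eq_of_polar hr (add_nonneg (azim_nonneg _ _ _) (azim_nonneg _ _ _)) h e

theorem azim_add_of_le {v u w p : R3} (hu : cr v u ≠ 0) (hw : cr v w ≠ 0) (hp : cr v p ≠ 0)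
    (h : 2 * Real.pi ≤ azim v u w + azim v w p) :
    azim v u p = azim v u w + azim v w p - 2 * Real.pi := by
  obtain ⟨r, hr, e⟩ := zc_add_polar hu hw hp
  refine azim_eq_of_polar hr (by linarith) ?_ ?_
  · linarith [azim_lt v u w, azim_lt v w p]
  · rw [e]
    congr 1
    rw [Complex.exp_eq_exp_iff_exists_int]
    exact ⟨1, by push_cast; ring⟩

/-- If the azimuth of `w` does not exceed that of `p`, the azimuths from `u` subtract. -/
theorem azim_sub {v u w p : R3} (hu : cr v u ≠ 0) (hw : cr v w ≠ 0) (hp : cr v p ≠ 0)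
    (h : azim v u w ≤ azim v u p) : azim v w p = azim v u p - azim v u w := by
  rcases lt_or_ge (azim v u w + azim v w p) (2 * Real.pi) with h1 | h1
  · rw [azim_add_of_lt hu hw hp h1]; ring
  · have := azim_add_of_le hu hw hp h1
    linarith [azim_lt v w p]

theorem azim_sub' {v u w p : R3} (hu : cr v u ≠ 0) (hw : cr v w ≠ 0) (hp : cr v p ≠ 0)
    (h : azim v u p < azim v u w) :
    azim v w p = azim v u p - azim v u w + 2 * Real.pi := by
  rcases lt_or_ge (azim v u w + azim v w p) (2 * Real.pi) with h1 | h1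
  · have := azim_add_of_lt hu hw hp h1
    linarith [azim_nonneg v w p]
  · rw [azim_add_of_le hu hw hp h1]; ring

/-- Azimuth zero means that `p` lies in the half-plane bounded by the axis that contains `u`. -/
theorem exists_comb_of_azim_eq_zero {v u p : R3} (hu : cr v u ≠ 0) (hp : cr v p ≠ 0)
    (h : azim v u p = 0) : ∃ s t : ℝ, 0 < t ∧ p = s • v + t • u := by
  have hv := norm_pos_of_cr hu
  have hz := zc_polar v u p
  rw [h] at hz
  simp only [Complex.ofReal_zero, zero_mul, Complex.exp_zero, mul_one] at hz
  have him : det3 v u p / ‖v‖ = 0 := by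
    have := congrArg Complex.im hz
    simpa [zc] using this
  have hd : det3 v u p = 0 := by
    rcases div_eq_zero_iff.1 him with h | h
    · exact h
    · exact absurd h hv.ne'
  have e := eq_comb_of_det3_eq_zero hu hd
  refine ⟨_, _, ?_, e⟩
  set t := coefB v u p / ‖cr v u‖ ^ 2
  have h2 : zc v u p = t * rho v u := by
    conv_lhs => rw [e]
    rw [zc_comb, zc_axis hv, zc_self hv]; ring
  have h3 : ‖zc v u p‖ = t * rho v u := by
    rw [h2] at hz
    rw [h2]
    exact_mod_cast hz.symm
  have h4 := norm_pos_iff.2 (zc_ne_zero hu hp)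
  rw [h3] at h4
  exact pos_of_mul_pos_left h4 (rho_pos hu).le

theorem azim_comb {v u w : R3} (hw : cr v w ≠ 0) (hu : cr v u ≠ 0) {s t : ℝ} (ht : 0 < t) :
    azim v w (s • v + t • u) = azim v w u := by
  have hv := norm_pos_of_cr hw
  refine azim_eq_of_polar (r := t * ‖zc v w u‖) ?_ (azim_nonneg _ _ _) (azim_lt _ _ _) ?_
  · have := norm_pos_iff.2 (zc_ne_zero hw hu)
    positivity
  · rw [zc_comb, zc_axis hv, mul_zero, zero_add]
    conv_lhs => rw [zc_polar v w u]
    push_cast; ring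

theorem azim_axis {v w : R3} (hv : 0 < ‖v‖) (s : ℝ) : azim v w (s • v) = 0 := by
  have : zc v w (s • v) = 0 := by
    have := zc_comb v w v v s 0
    rw [zc_axis hv] at this
    simpa using this
  rw [azim_eq_zc, this, Complex.arg_zero, toIcoMod_eq_self]
  exact ⟨le_rfl, by simp [Real.pi_pos]⟩

/-! ### Small sectors about a node -/

/-- The projection of `w` to the plane orthogonal to `v`. -/
def proj (v w : R3) : R3 := w - (inner ℝ w v / ‖v‖ ^ 2) • v

/-- Cylindrical coordinates about the axis through `v`, the azimuth being measured from `w`. -/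
def cyl (v w : R3) (s r φ : ℝ) : R3 :=
  s • v + (r * Real.cos φ) • proj v w + (r * Real.sin φ / ‖v‖) • cr v w

theorem cyl_eq (v w : R3) (s r φ : ℝ) :
    cyl v w s r φ = (1 : ℝ) • ((s - r * Real.cos φ * (inner ℝ w v / ‖v‖ ^ 2)) • v +
      (r * Real.cos φ) • w) + (r * Real.sin φ / ‖v‖) • cr v w := by
  unfold cyl proj
  module

theorem zc_cyl {v w : R3} (hv : 0 < ‖v‖) (s r φ : ℝ) :
    zc v w (cyl v w s r φ) = (r * rho v w : ℝ) * Complex.exp (φ * Complex.I) := by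
  rw [cyl_eq, zc_comb, zc_comb, zc_axis hv, zc_self hv, zc_cr, Complex.exp_mul_I,
    ← Complex.ofReal_cos, ← Complex.ofReal_sin]
  have : ‖cr v w‖ ^ 2 / ‖v‖ = rho v w * ‖v‖ := by unfold rho; field_simp
  rw [this]
  have hv' : (‖v‖ : ℂ) ≠ 0 := by exact_mod_cast hv.ne'
  push_cast
  field_simp
  ring

theorem azim_cyl {v w : R3} (h : cr v w ≠ 0) {s r φ : ℝ} (hr : 0 < r) (h0 : 0 ≤ φ)
    (h1 : φ < 2 * Real.pi) : azim v w (cyl v w s r φ) = φ :=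
  azim_eq_of_polar (mul_pos hr (rho_pos h)) h0 h1 (zc_cyl (norm_pos_of_cr h) s r φ)

theorem expand_proj {v w : R3} (h : cr v w ≠ 0) (p : R3) :
    p = (inner ℝ p v / ‖v‖ ^ 2) • v + ((zc v w p).re / rho v w) • proj v w +
      ((zc v w p).im / rho v w / ‖v‖) • cr v w := by
  have hv := norm_pos_of_cr h
  have hC : 0 < ‖cr v w‖ ^ 2 := by positivity
  have hN := norm_sq_eq_coord v
  have key : (‖cr v w‖ ^ 2 * ‖v‖ ^ 2) • p = (‖cr v w‖ ^ 2 * inner ℝ p v) • v +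
      (inner ℝ w p * ‖v‖ ^ 2 - inner ℝ w v * inner ℝ p v) • (‖v‖ ^ 2 • w - inner ℝ w v • v) +
      (det3 v w p * ‖v‖ ^ 2) • cr v w := by
    rw [hN, norm_sq_eq_coord (cr v w)]
    apply ext3 <;> simp only [PiLp.add_apply, PiLp.smul_apply, PiLp.sub_apply, smul_eq_mul,
      cr_zero, cr_one, cr_two, inner_eq_coord, det3_eq_coord] <;> ring
  have hne : ‖cr v w‖ ^ 2 * ‖v‖ ^ 2 ≠ 0 := by positivity
  apply smul_right_injective R3 hne
  simp only
  rw [key]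
  unfold zc rho proj
  simp only [smul_add, smul_sub, smul_smul]
  have hv2 : ‖v‖ ≠ 0 := hv.ne'
  have hc2 : ‖cr v w‖ ≠ 0 := by simpa using h
  congr 1
  · congr 1
    · congr 1; field_simp
    · congr 2 <;> field_simp
  · congr 1; field_simp

theorem exists_cyl {v w : R3} (h : cr v w ≠ 0) (p : R3) :
    p = cyl v w (inner ℝ p v / ‖v‖ ^ 2) (‖zc v w p‖ / rho v w) (azim v w p) := by
  conv_lhs => rw [expand_proj h p]
  have hz := zc_polar v w p
  rw [Complex.exp_mul_I, ← Complex.ofReal_cos, ← Complex.ofReal_sin] at hz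
  have hre : (zc v w p).re = ‖zc v w p‖ * Real.cos (azim v w p) := by
    have := congrArg Complex.re hz
    rwa [Complex.re_ofReal_mul, Complex.add_re, Complex.ofReal_re, Complex.re_ofReal_mul,
      Complex.I_re, mul_zero, add_zero] at this
  have him : (zc v w p).im = ‖zc v w p‖ * Real.sin (azim v w p) := by
    have := congrArg Complex.im hz
    rwa [Complex.im_ofReal_mul, Complex.add_im, Complex.ofReal_im, Complex.im_ofReal_mul,
      Complex.I_im, mul_one, zero_add] at this
  unfold cyl
  rw [hre, him, div_mul_eq_mul_div, div_mul_eq_mul_div]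

/-- The distance to `v` does not depend on the azimuth. -/
theorem norm_cyl_sub {v w : R3} (hv : 0 < ‖v‖) (s r φ : ℝ) :
    ‖cyl v w s r φ - v‖ = ‖(s - 1) • v + r • proj v w‖ := by
  have hN := norm_sq_eq_coord v
  have o1 : inner ℝ v (proj v w) = 0 := by
    unfold proj
    rw [inner_sub_right, real_inner_smul_right, real_inner_self_eq_norm_sq, real_inner_comm]
    field_simp; ring
  have o2 : inner ℝ v (cr v w) = 0 := by
    simp only [inner_eq_coord, cr_zero, cr_one, cr_two]; ring
  have o3 : inner ℝ (proj v w) (cr v w) = 0 := by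
    unfold proj
    rw [inner_sub_left, real_inner_smul_left, o2, mul_zero, sub_zero]
    simp only [inner_eq_coord, cr_zero, cr_one, cr_two]; ring
  have n1 : ‖cr v w‖ ^ 2 = ‖v‖ ^ 2 * ‖proj v w‖ ^ 2 := by
    have : ‖proj v w‖ ^ 2 = ‖w‖ ^ 2 - inner ℝ w v ^ 2 / ‖v‖ ^ 2 := by
      unfold proj
      rw [norm_sub_sq_real, real_inner_smul_right, norm_smul, mul_pow, Real.norm_eq_abs, sq_abs]
      field_simp; ring
    rw [this, mul_sub, mul_div_cancel₀ _ (by positivity), hN, norm_sq_eq_coord w,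
      norm_sq_eq_coord (cr v w), inner_eq_coord]
    simp only [cr_zero, cr_one, cr_two]; ring
  rw [← sq_eq_sq₀ (norm_nonneg _) (norm_nonneg _)]
  have e : cyl v w s r φ - v = (s - 1) • v + (r * Real.cos φ) • proj v w +
      (r * Real.sin φ / ‖v‖) • cr v w := by unfold cyl; module
  rw [e, norm_add_sq_real, norm_add_sq_real, norm_add_sq_real]
  simp only [inner_add_left, real_inner_smul_left, real_inner_smul_right, o1, o2, o3, norm_smul,
    mul_pow, Real.norm_eq_abs, sq_abs, n1]
  have := Real.sin_sq_add_cos_sq φ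
  field_simp
  linear_combination ‖v‖ * ‖proj v w‖ ^ 2 * r ^ 2 * this

theorem continuous_cyl (v w : R3) :
    Continuous fun x : ℝ × ℝ × ℝ => cyl v w x.1 x.2.1 x.2.2 := by
  unfold cyl; fun_prop

/-- A ball about `v` meets the set of points with azimuth between `0` and `θ` in a connected set. -/
theorem isPreconnected_sector {v w : R3} (h : cr v w ≠ 0) {θ : ℝ} (hθ : θ ≤ 2 * Real.pi)
    (δ : ℝ) : IsPreconnected (Metric.ball v δ ∩ {p | 0 < azim v w p ∧ azim v w p < θ}) := by
  have hv := norm_pos_of_cr h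
  -- In cylindrical coordinates the set is convex.
  let L : ℝ × ℝ × ℝ → R3 := fun x => (x.1 - 1) • v + x.2.1 • proj v w
  let Dm : Set (ℝ × ℝ × ℝ) := {x | L x ∈ Metric.ball 0 δ ∧ 0 < x.2.1 ∧ x.2.2 ∈ Ioo 0 θ}
  have hconv : Convex ℝ Dm := by
    rintro x ⟨hx1, hx2, hx3⟩ y ⟨hy1, hy2, hy3⟩ a b ha hb hab
    refine ⟨?_, ?_, convex_Ioo 0 θ hx3 hy3 ha hb hab⟩
    · have e : L (a • x + b • y) = a • L x + b • L y := by
        simp only [L, Prod.fst_add, Prod.snd_add, Prod.smul_fst, Prod.smul_snd, smul_eq_mul]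
        rw [show b = 1 - a by linarith]
        module
      rw [e]
      exact convex_ball _ _ hx1 hy1 ha hb hab
    · exact convex_Ioi (0 : ℝ) hx2 hy2 ha hb hab
  have himg : Metric.ball v δ ∩ {p | 0 < azim v w p ∧ azim v w p < θ} =
      (fun x : ℝ × ℝ × ℝ => cyl v w x.1 x.2.1 x.2.2) '' Dm := by
    ext p
    constructor
    · rintro ⟨hp, h0, h1⟩
      have e := exists_cyl h p
      refine ⟨(inner ℝ p v / ‖v‖ ^ 2, ‖zc v w p‖ / rho v w, azim v w p), ⟨?_, ?_, h0, h1⟩, e.symm⟩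
      · rw [mem_ball_zero_iff, ← norm_cyl_sub hv _ _ (azim v w p), ← e]
        exact mem_ball_iff_norm.1 hp
      · have : zc v w p ≠ 0 := by
          intro hz
          rw [azim_eq_zc, hz, Complex.arg_zero,
            (toIcoMod_eq_self Real.two_pi_pos).2 ⟨le_rfl, by simp [Real.pi_pos]⟩] at h0
          exact lt_irrefl _ h0
        have h3 := rho_pos h
        have h4 := norm_pos_iff.2 this
        change 0 < ‖zc v w p‖ / rho v w
        positivity
    · rintro ⟨⟨s, r, φ⟩, ⟨h1, h2, h3, h4⟩, rfl⟩
      have e : azim v w (cyl v w s r φ) = φ := azim_cyl h h2 h3.le (lt_of_lt_of_le h4 hθ)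
      refine ⟨?_, ?_⟩
      · rw [mem_ball_iff_norm, norm_cyl_sub hv]
        exact mem_ball_zero_iff.1 h1
      · change 0 < azim v w (cyl v w s r φ) ∧ azim v w (cyl v w s r φ) < θ
        rw [e]; exact ⟨h3, h4⟩
  rw [himg]
  exact hconv.isPreconnected.image _ (continuous_cyl v w).continuousOn

theorem azim_eq_arg {v u p : R3} (h : 0 ≤ Complex.arg (zc v u p)) :
    azim v u p = Complex.arg (zc v u p) := by
  rw [azim_eq_zc, toIcoMod_eq_self]
  exact ⟨h, by linarith [Complex.arg_le_pi (zc v u p), Real.pi_pos]⟩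

theorem azim_eq_arg_add {v u p : R3} (h : Complex.arg (zc v u p) < 0) :
    azim v u p = Complex.arg (zc v u p) + 2 * Real.pi := by
  rw [azim_eq_zc, ← toIcoMod_add_right, toIcoMod_eq_self]
  exact ⟨by linarith [Complex.neg_pi_lt_arg (zc v u p), Real.pi_pos], by linarith⟩

theorem tendsto_arg_near {v w : R3} (h : cr v w ≠ 0) {s t : ℝ} (ht : 0 < t) :
    Tendsto (fun p => Complex.arg (zc v w p)) (𝓝 (s • v + t • w)) (𝓝 0) := by
  have hv := norm_pos_of_cr h
  have hz : zc v w (s • v + t • w) = (t * rho v w : ℝ) := by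
    rw [zc_comb, zc_axis hv, zc_self hv]; push_cast; ring
  have hpos : 0 < t * rho v w := mul_pos ht (rho_pos h)
  have hc : Continuous (zc v w) := by
    have : zc v w = fun p => ((inner ℝ w p - inner ℝ w v * inner ℝ p v / ‖v‖ ^ 2 : ℝ) : ℂ) +
        ((det3 v w p / ‖v‖ : ℝ) : ℂ) * Complex.I := by
      ext p
      exact (Complex.mk_eq_add_mul_I _ _)
    rw [this]
    have hd : Continuous fun p => det3 v w p :=
      continuous_det3 continuous_const continuous_const continuous_id
    fun_prop
  have ha : ContinuousAt Complex.arg (zc v w (s • v + t • w)) := by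
    refine Complex.continuousAt_arg ?_
    rw [hz]
    exact Complex.ofReal_mem_slitPlane.2 hpos
  have := ha.tendsto.comp hc.continuousAt
  rwa [hz, Complex.arg_ofReal_of_nonneg hpos.le] at this

/-- Near a point of the open arc from `v` to `w`, the points to the left of the arc have small
azimuth. -/
theorem eventually_azim_left {v w : R3} (h : cr v w ≠ 0) {s t θ : ℝ} (ht : 0 < t) (hθ : 0 < θ) :
    ∀ᶠ p in 𝓝 (s • v + t • w), 0 < det3 v w p → 0 < azim v w p ∧ azim v w p < θ := by
  have hv := norm_pos_of_cr h
  filter_upwards [(tendsto_arg_near h ht).eventually_lt_const hθ] with p hp hd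
  have him : 0 < (zc v w p).im := div_pos hd hv
  have h1 : 0 ≤ Complex.arg (zc v w p) := Complex.arg_nonneg_iff.2 him.le
  rw [azim_eq_arg h1]
  refine ⟨lt_of_le_of_ne h1 fun h0 => ?_, hp⟩
  exact him.ne' (Complex.arg_eq_zero_iff.1 h0.symm).2

/-- Near a point of the open arc from `v` to `w`, the points to the right of the arc have azimuth
close to the full angle. -/
theorem eventually_azim_right {v w : R3} (h : cr v w ≠ 0) {s t η : ℝ} (ht : 0 < t) (hη : 0 < η) :
    ∀ᶠ p in 𝓝 (s • v + t • w), det3 v w p < 0 →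
      2 * Real.pi - η < azim v w p ∧ azim v w p < 2 * Real.pi := by
  have hv := norm_pos_of_cr h
  filter_upwards [(tendsto_arg_near h ht).eventually_const_lt (neg_lt_zero.2 hη)] with p hp hd
  have him : (zc v w p).im < 0 := div_neg_of_neg_of_pos hd hv
  have h1 : Complex.arg (zc v w p) < 0 := Complex.arg_neg_iff.2 him
  rw [azim_eq_arg_add h1]
  constructor <;> linarith

/-! ### Edges and blades of a fan -/

variable {V : Set R3} {E : Set (Set R3)}

theorem IsFan.edge_mem (h : IsFan V E) {v w : R3} (e : ({v, w} : Set R3) ∈ E) :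
    v ∈ V ∧ w ∈ V ∧ v ≠ w := by
  obtain ⟨a, ha, b, hb, hab, he⟩ := h.edges _ e
  rcases Set.pair_eq_pair_iff.1 he with ⟨rfl, rfl⟩ | ⟨rfl, rfl⟩
  · exact ⟨ha, hb, hab⟩
  · exact ⟨hb, ha, hab.symm⟩

theorem IsFan.cr_ne_zero (h : IsFan V E) {v w : R3} (e : ({v, w} : Set R3) ∈ E) : cr v w ≠ 0 :=
  cr_ne_zero_of_not_collinear (h.nonparallel v w e)

theorem IsFan.finite_edges (h : IsFan V E) : E.Finite := by
  refine (h.finite.finite_subsets).subset fun ε hε => ?_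
  obtain ⟨a, ha, b, hb, -, rfl⟩ := h.edges _ hε
  exact Set.pair_subset ha hb

theorem IsFan.mono (h : IsFan V E) {E' : Set (Set R3)} (hE : E' ⊆ E) : IsFan V E' where
  edges ε hε := h.edges ε (hE hε)
  finite := h.finite
  nonempty := h.nonempty
  origin := h.origin
  nonparallel v w e := h.nonparallel v w (hE e)
  intersection ε hε ε' hε' := h.intersection ε (Set.union_subset_union_left _ hE hε) ε'
    (Set.union_subset_union_left _ hE hε')

theorem IsFan.isClosed_cone (h : IsFan V E) {ε : Set R3} (hε : ε ∈ E) : IsClosed (cone ε) := by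
  obtain ⟨a, ha, b, hb, -, rfl⟩ := h.edges _ hε
  exact isClosed_cone_pair (h.cr_ne_zero hε)

theorem IsFan.isOpen_Y (h : IsFan V E) : IsOpen (Y V E) :=
  (h.finite_edges.isClosed_biUnion fun _ hε => h.isClosed_cone hε).isOpen_compl

theorem exists_eq_pair (h : IsFan V E) {ε : Set R3} (hε : ε ∈ E) {v : R3} (hv : v ∈ ε) :
    ∃ w, ε = {v, w} := by
  obtain ⟨a, ha, b, hb, -, rfl⟩ := h.edges _ hε
  rcases hv with rfl | rfl
  · exact ⟨b, rfl⟩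
  · exact ⟨a, Set.pair_comm _ _⟩

/-- A point of the relative interior of a blade lies in no other blade. -/
theorem IsFan.notMem_cone (h : IsFan V E) {v w : R3} (e : ({v, w} : Set R3) ∈ E) {s t : ℝ}
    (hs : 0 < s) (ht : 0 < t) {ε : Set R3} (hε : ε ∈ E) (hne : ε ≠ {v, w}) :
    s • v + t • w ∉ cone ε := by
  intro hx
  have hcr := h.cr_ne_zero e
  have h1 : s • v + t • w ∈ cone ({v, w} ∩ ε) := by
    rw [← h.intersection _ (Or.inl e) _ (Or.inl hε)]
    exact ⟨mem_cone_pair.2 ⟨s, t, hs.le, ht.le, rfl⟩, hx⟩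
  have hvw := (h.edge_mem e).2.2
  by_cases hv : v ∈ ε <;> by_cases hw : w ∈ ε
  · obtain ⟨b, rfl⟩ := exists_eq_pair h hε hv
    rcases hw with hw | hw
    · exact hvw hw.symm
    · rw [Set.mem_singleton_iff] at hw
      exact hne (by rw [hw])
  · rw [Set.insert_inter_of_mem hv, Set.singleton_inter_eq_empty.2 hw] at h1
    obtain ⟨r, -, hr⟩ := mem_cone_singleton.1 (by simpa using h1)
    have := comb_unique (s' := r) (t' := 0) hcr (by rw [hr]; simp)
    exact ht.ne' this.2
  · rw [Set.insert_inter_of_notMem hv, Set.singleton_inter_of_mem hw] at h1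
    obtain ⟨r, -, hr⟩ := mem_cone_singleton.1 h1
    have := comb_unique (s' := 0) (t' := r) hcr (by rw [hr]; simp)
    exact hs.ne' this.1
  · rw [Set.insert_inter_of_notMem hv, Set.singleton_inter_eq_empty.2 hw, mem_cone_empty] at h1
    have := comb_unique (s' := 0) (t' := 0) hcr (by rw [h1]; simp)
    exact hs.ne' this.1

/-- A node lies on no blade of which it is not an end. -/
theorem IsFan.node_notMem_cone (h : IsFan V E) {v : R3} (hv : v ∈ V) {ε : Set R3} (hε : ε ∈ E)
    (hne : v ∉ ε) : v ∉ cone ε := by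
  intro hx
  have h1 : v ∈ cone (ε ∩ {v}) := by
    rw [← h.intersection _ (Or.inl hε) _ (Or.inr ⟨v, hv, rfl⟩)]
    exact ⟨hx, mem_cone_singleton.2 ⟨1, zero_le_one, by simp⟩⟩
  rw [Set.inter_singleton_eq_empty.2 hne, mem_cone_empty] at h1
  exact h.origin (h1 ▸ hv)

theorem mem_nbrs {v w : R3} : w ∈ nbrs E v ↔ ({v, w} : Set R3) ∈ E := Iff.rfl

theorem mem_nbrs_comm {v w : R3} : w ∈ nbrs E v ↔ v ∈ nbrs E w := by
  rw [mem_nbrs, mem_nbrs, Set.pair_comm]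

theorem IsFan.finite_nbrs (h : IsFan V E) (v : R3) : (nbrs E v).Finite :=
  h.finite.subset fun _ hw => (h.edge_mem hw).2.1

/-- Distinct neighbours of a node are seen from it at distinct azimuths. -/
theorem IsFan.azim_injOn (h : IsFan V E) {v w u u' : R3} (hw : w ∈ nbrs E v) (hu : u ∈ nbrs E v)
    (hu' : u' ∈ nbrs E v) (e : azim v w u = azim v w u') : u = u' := by
  have cw := h.cr_ne_zero hw
  have cu := h.cr_ne_zero hu
  have cu' := h.cr_ne_zero hu'
  have h0 : azim v u u' = 0 := by rw [azim_sub cw cu cu' e.le, e, sub_self]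
  obtain ⟨s, t, ht, hst⟩ := exists_comb_of_azim_eq_zero cu cu' h0
  by_contra hne
  -- `u'` is in the half-plane of `u`, so that one of the two lies on the blade of the other.
  rcases le_or_gt 0 s with hs | hs
  · refine h.node_notMem_cone (h.edge_mem hu').2.1 hu ?_ (mem_cone_pair.2 ⟨s, t, hs, ht.le, hst⟩)
    rintro (h1 | h1)
    · exact (h.edge_mem hu').2.2 h1.symm
    · exact hne h1.symm
  · refine h.node_notMem_cone (h.edge_mem hu).2.1 hu' ?_
      (mem_cone_pair.2 ⟨-s / t, 1 / t, div_nonneg (by linarith) ht.le, by positivity, ?_⟩)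
    · rintro (h1 | h1)
      · exact (h.edge_mem hu).2.2 h1.symm
      · exact hne h1
    · rw [hst, smul_add, smul_smul, smul_smul, one_div, inv_mul_cancel₀ ht.ne', one_smul,
        ← add_assoc, ← add_smul]
      have : -s / t + t⁻¹ * s = 0 := by field_simp; ring
      rw [this, zero_smul, zero_add]

theorem IsFan.azim_pos (h : IsFan V E) {v w u : R3} (hw : w ∈ nbrs E v) (hu : u ∈ nbrs E v)
    (hne : u ≠ w) : 0 < azim v w u := by
  refine lt_of_le_of_ne (azim_nonneg _ _ _) fun h0 => hne ?_
  exact (h.azim_injOn hw hw hu (by rw [azim_self (h.cr_ne_zero hw), h0])).symm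

/-! ### The cyclic order of the neighbours of a node -/

/-- The defining property of the successor `σ(v, w)`. -/
theorem IsFan.sigma_spec (h : IsFan V E) {v w : R3} (hne : ∃ u ∈ nbrs E v, u ≠ w) :
    sigma E v w ∈ nbrs E v ∧ sigma E v w ≠ w ∧
      ∀ u' ∈ nbrs E v, u' ≠ w → azim v w (sigma E v w) ≤ azim v w u' := by
  have hex : ∃ u ∈ nbrs E v, u ≠ w ∧ ∀ u' ∈ nbrs E v, u' ≠ w → azim v w u ≤ azim v w u' := by
    obtain ⟨u0, hu0, hn0⟩ := hne
    obtain ⟨u, hu, hmin⟩ := ((h.finite_nbrs v).subset (Set.sep_subset _ fun u => u ≠ w))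
      |>.exists_minimalFor (azim v w) _ ⟨u0, hu0, hn0⟩
    refine ⟨u, hu.1, hu.2, fun u' h1 h2 => ?_⟩
    rcases le_total (azim v w u) (azim v w u') with h3 | h3
    · exact h3
    · exact hmin ⟨h1, h2⟩ h3
  have e : sigma E v w = hex.choose := dif_pos hex
  rw [e]
  exact hex.choose_spec

theorem sigma_eq_self {v w : R3} (hne : ¬ ∃ u ∈ nbrs E v, u ≠ w) : sigma E v w = w :=
  dif_neg fun ⟨u, hu, hu', _⟩ => hne ⟨u, hu, hu'⟩

theorem IsFan.sigma_mem (h : IsFan V E) {v w : R3} (hw : w ∈ nbrs E v) :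
    sigma E v w ∈ nbrs E v := by
  by_cases hne : ∃ u ∈ nbrs E v, u ≠ w
  · exact (h.sigma_spec hne).1
  · rwa [sigma_eq_self hne]

theorem IsFan.sigma_injOn (h : IsFan V E) (v : R3) : Set.InjOn (sigma E v) (nbrs E v) := by
  intro w hw w' hw' e
  by_contra hne
  obtain ⟨hu, huw, hmin⟩ := h.sigma_spec ⟨w', hw', fun h' => hne h'.symm⟩
  obtain ⟨-, huw', hmin'⟩ := h.sigma_spec ⟨w, hw, hne⟩
  rw [← e] at huw' hmin'
  have cw := h.cr_ne_zero hw
  have cw' := h.cr_ne_zero hw'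
  have cu := h.cr_ne_zero hu
  have hlt : azim v w (sigma E v w) < azim v w w' :=
    lt_of_le_of_ne (hmin w' hw' fun h' => hne h'.symm) fun h' =>
      huw' (h.azim_injOn hw hu hw' h')
  have h1 := azim_sub' cw cw' cu hlt
  have h2 : azim v w' w = azim v w w - azim v w w' + 2 * Real.pi := by
    refine azim_sub' cw cw' cw ?_
    rw [azim_self cw]
    exact lt_of_le_of_lt (azim_nonneg _ _ _) hlt
  rw [azim_self cw] at h2
  have h3 := hmin' w hw hne
  have h4 := h.azim_pos hw hu huw
  linarith

theorem IsFan.sigma_bijOn (h : IsFan V E) (v : R3) :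
    Set.BijOn (sigma E v) (nbrs E v) (nbrs E v) := by
  have hmaps : Set.MapsTo (sigma E v) (nbrs E v) (nbrs E v) := fun _ hw => h.sigma_mem hw
  refine ⟨hmaps, h.sigma_injOn v, ?_⟩
  rw [Set.SurjOn, Set.eq_of_subset_of_ncard_le hmaps.image_subset
    (h.sigma_injOn v).ncard_image.ge (h.finite_nbrs v)]

/-- A set of neighbours of `v` that is closed under the successor map is empty or contains all
neighbours: the predecessor in azimuth of a missing neighbour would be mapped out of the set. -/
theorem IsFan.sigma_transitive (h : IsFan V E) {v w : R3} {S : Set R3} (hS : S ⊆ nbrs E v)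
    (hw : w ∈ S) (hσ : ∀ u ∈ S, sigma E v u ∈ S) : S = nbrs E v := by
  refine hS.antisymm fun u hu => ?_
  by_contra huS
  obtain ⟨w', hw', hmin⟩ := ((h.finite_nbrs v).subset hS).exists_minimalFor
    (fun x => azim v x u) S ⟨w, hw⟩
  have hne : u ≠ w' := fun h' => huS (h' ▸ hw')
  obtain ⟨h1, h2, h3⟩ := h.sigma_spec ⟨u, hu, hne⟩
  have hsS := hσ w' hw'
  have c1 := h.cr_ne_zero (hS hw')
  have c2 := h.cr_ne_zero h1
  have c3 := h.cr_ne_zero hu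
  have h4 := azim_sub c1 c2 c3 (h3 u hu hne)
  have h5 := h.azim_pos (hS hw') h1 h2
  have h6 : azim v (sigma E v w') u < azim v w' u := by linarith
  exact absurd (hmin hsS h6.le) h6.not_ge

/-! ### The faces into which the darts lead -/

/-- The angle of a nonisolated dart `(v, w)`. -/
def theta (E : Set (Set R3)) (v w : R3) : ℝ :=
  open Classical in if nbrs E v = {w} then 2 * Real.pi else azim v w (sigma E v w)

theorem exists_ne_of_ne_singleton {v w : R3} (hw : w ∈ nbrs E v) (hs : nbrs E v ≠ {w}) :
    ∃ u ∈ nbrs E v, u ≠ w := by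
  by_contra! hn
  exact hs (Set.eq_singleton_iff_unique_mem.2 ⟨hw, hn⟩)

theorem IsFan.theta_pos (h : IsFan V E) {v w : R3} (hw : w ∈ nbrs E v) : 0 < theta E v w := by
  unfold theta
  split_ifs with hs
  · exact Real.two_pi_pos
  · obtain ⟨h1, h2, -⟩ := h.sigma_spec (exists_ne_of_ne_singleton hw hs)
    exact h.azim_pos hw h1 h2

theorem theta_le (v w : R3) : theta E v w ≤ 2 * Real.pi := by
  unfold theta
  split_ifs with hs
  · exact le_rfl
  · exact (azim_lt _ _ _).le

/-- There is no neighbour strictly between a neighbour and its successor. -/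
theorem IsFan.theta_le_azim (h : IsFan V E) {v w u : R3} (hu : u ∈ nbrs E v) (hne : u ≠ w) :
    theta E v w ≤ azim v w u := by
  unfold theta
  rw [if_neg]
  · exact (h.sigma_spec ⟨u, hu, hne⟩).2.2 u hu hne
  · intro hs
    rw [hs] at hu
    exact hne hu

theorem wedge_eq {v w : R3} (hw : w ∈ nbrs E v) :
    wedge E (v, w) = {p | 0 < azim v w p ∧ azim v w p < theta E v w} := by
  unfold wedge theta
  simp only
  rw [if_neg (Set.nonempty_iff_ne_empty.1 ⟨w, hw⟩)]
  split_ifs <;> rfl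

theorem wedge_isolated {v : R3} (hv : nbrs E v = ∅) :
    wedge E (v, v) = {p | p ∉ Submodule.span ℝ {v}} := by
  unfold wedge
  rw [if_pos hv]

/-- Near a node, only the blades at the node are visible. -/
theorem IsFan.exists_ball (h : IsFan V E) {v : R3} (hv : v ∈ V) :
    ∃ δ > 0, ∀ p ∈ Metric.ball v δ, p ∈ X V E → ∃ u ∈ nbrs E v, p ∈ cone {v, u} := by
  have hev : ∀ᶠ p in 𝓝 v, ∀ ε ∈ E, v ∉ ε → p ∉ cone ε := by
    rw [Filter.eventually_all_finite h.finite_edges]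
    intro ε hε
    by_cases hvε : v ∈ ε
    · exact Eventually.of_forall fun p h' => absurd hvε h'
    · filter_upwards [(h.isClosed_cone hε).isOpen_compl.eventually_mem
        (h.node_notMem_cone hv hε hvε)] with p hp _ using hp
  obtain ⟨δ, hδ, hb⟩ := Metric.eventually_nhds_iff_ball.1 hev
  refine ⟨δ, hδ, fun p hp hX => ?_⟩
  obtain ⟨ε, hε, hpε⟩ := Set.mem_iUnion₂.1 hX
  by_cases hvε : v ∈ ε
  · obtain ⟨u, rfl⟩ := exists_eq_pair h hε hvε
    exact ⟨u, hε, hpε⟩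
  · exact absurd hpε (hb p hp ε hε hvε)

/-- The blades at a node avoid the wedges of the darts at the node. -/
theorem IsFan.wedge_disjoint (h : IsFan V E) {v w u p : R3} (hw : w ∈ nbrs E v)
    (hu : u ∈ nbrs E v) (hp : p ∈ cone {v, u}) : p ∉ wedge E (v, w) := by
  rw [wedge_eq hw]
  rintro ⟨h0, h1⟩
  have cw := h.cr_ne_zero hw
  obtain ⟨s, t, hs, ht, rfl⟩ := mem_cone_pair.1 hp
  rcases ht.eq_or_lt with rfl | ht
  · rw [zero_smul, add_zero, azim_axis (norm_pos_of_cr cw)] at h0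
    exact lt_irrefl _ h0
  · rw [azim_comb cw (h.cr_ne_zero hu) ht] at h0 h1
    by_cases hne : u = w
    · rw [hne, azim_self cw] at h0
      exact lt_irrefl _ h0
    · exact absurd (h.theta_le_azim hu hne) h1.not_ge

/-- The wedge of a dart comes arbitrarily close to the node. -/
theorem nonempty_ball_inter_wedge (h : IsFan V E) {x : R3 × R3} (hx : x ∈ darts V E) {δ : ℝ}
    (hδ : 0 < δ) : (Metric.ball x.1 δ ∩ wedge E x).Nonempty := by
  obtain ⟨v, w⟩ := x
  rcases hx with hx | ⟨hv, hn, hwv⟩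
  · have hw : w ∈ nbrs E v := hx
    have cw := h.cr_ne_zero hw
    have hθ := h.theta_pos hw
    have hc : ContinuousAt (fun r : ℝ => cyl v w 1 r (theta E v w / 2)) 0 :=
      ((continuous_cyl v w).comp (by fun_prop :
        Continuous fun r : ℝ => ((1 : ℝ), r, theta E v w / 2))).continuousAt
    have h0 : cyl v w 1 0 (theta E v w / 2) = v := by simp [cyl]
    have hev := (hc.eventually_mem (by rw [h0]; exact Metric.ball_mem_nhds v hδ)).filter_mono
      (nhdsWithin_le_nhds (s := Ioi 0))
    obtain ⟨r, hr, hr0⟩ := (hev.and self_mem_nhdsWithin).exists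
    refine ⟨_, hr, ?_⟩
    rw [wedge_eq hw]
    change 0 < azim v w _ ∧ azim v w _ < _
    rw [azim_cyl cw hr0 (by linarith) (by linarith [theta_le (E := E) v w])]
    constructor <;> linarith
  · simp only at hv hn hwv
    subst w
    have hv0 : v ≠ 0 := fun h0 => h.origin (h0 ▸ hv)
    obtain ⟨e, he⟩ := exists_cr_ne_zero hv0
    have hc : ContinuousAt (fun t : ℝ => v + t • cr v e) 0 := by fun_prop
    have hev := (hc.eventually_mem (by
      rw [zero_smul, add_zero]; exact Metric.ball_mem_nhds v hδ)).filter_mono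
      (nhdsWithin_le_nhds (s := Ioi 0))
    obtain ⟨t, ht, ht0⟩ := (hev.and self_mem_nhdsWithin).exists
    refine ⟨_, ht, ?_⟩
    rw [wedge_isolated hn]
    intro hmem
    obtain ⟨a, ha⟩ := Submodule.mem_span_singleton.1 hmem
    have h1 := det3_comb v e v (cr v e) 1 t
    rw [one_smul, ← ha, det3_self_left, det3_cr] at h1
    have h2 := det3_comb_self v e a 0
    rw [zero_smul, add_zero] at h2
    rw [h2] at h1
    have : 0 < ‖cr v e‖ ^ 2 := by positivity
    have ht0 : 0 < t := ht0
    nlinarith [mul_pos ht0 this]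

theorem eq_of_mem_topComponents {A U U' : Set R3} (hU : U ∈ topComponents A)
    (hU' : U' ∈ topComponents A) {p : R3} (hp : p ∈ U) (hp' : p ∈ U') : U = U' := by
  obtain ⟨a, ha, rfl⟩ := hU
  obtain ⟨b, hb, rfl⟩ := hU'
  rw [connectedComponentIn_eq hp, connectedComponentIn_eq hp']

theorem subset_of_mem_topComponents {A U C : Set R3} (hU : U ∈ topComponents A)
    (hC : IsPreconnected C) (hCA : C ⊆ A) (hne : (C ∩ U).Nonempty) : C ⊆ U := by
  obtain ⟨a, ha, rfl⟩ := hU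
  obtain ⟨p, hpC, hpU⟩ := hne
  rw [connectedComponentIn_eq hpU]
  exact hC.subset_connectedComponentIn hpC hCA

theorem exists_topComponent {A C : Set R3} (hC : IsPreconnected C) (hCA : C ⊆ A)
    (hne : C.Nonempty) : ∃ U ∈ topComponents A, C ⊆ U := by
  obtain ⟨p, hp⟩ := hne
  exact ⟨_, ⟨p, hCA hp, rfl⟩, hC.subset_connectedComponentIn hp hCA⟩

/-- Every dart leads into a face, which contains the part near the node of the wedge of the
dart. -/
theorem IsFan.exists_face (h : IsFan V E) {x : R3 × R3} (hx : x ∈ darts V E) :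
    ∃ U ∈ topComponents (Y V E), ∃ δ > 0, Metric.ball x.1 δ ∩ wedge E x ⊆ U := by
  obtain ⟨v, w⟩ := x
  rcases hx with hx | ⟨hv, hn, hwv⟩
  · have hw : w ∈ nbrs E v := hx
    obtain ⟨δ, hδ, hb⟩ := h.exists_ball (h.edge_mem hw).1
    have hpre : IsPreconnected (Metric.ball v δ ∩ wedge E (v, w)) := by
      rw [wedge_eq hw]
      exact isPreconnected_sector (h.cr_ne_zero hw) (theta_le v w) δ
    have hY : Metric.ball v δ ∩ wedge E (v, w) ⊆ Y V E := by
      rintro p ⟨hp, hpw⟩ hX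
      obtain ⟨u, hu, hpu⟩ := hb p hp hX
      exact h.wedge_disjoint hw hu hpu hpw
    obtain ⟨U, hU, hsub⟩ := exists_topComponent hpre hY
      (nonempty_ball_inter_wedge h (Or.inl hx) hδ)
    exact ⟨U, hU, δ, hδ, hsub⟩
  · simp only at hv hn hwv
    subst w
    obtain ⟨δ, hδ, hb⟩ := h.exists_ball hv
    have hY : Metric.ball v δ ⊆ Y V E := by
      intro p hp hX
      obtain ⟨u, hu, -⟩ := hb p hp hX
      rw [hn] at hu
      exact hu
    obtain ⟨U, hU, hsub⟩ := exists_topComponent (convex_ball v δ).isPreconnected hY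
      ⟨v, Metric.mem_ball_self hδ⟩
    exact ⟨U, hU, δ, hδ, Set.inter_subset_left.trans hsub⟩

open Classical in
/-- The face into which a dart leads; the empty set for pairs that are not darts of a fan. -/
def dface (V : Set R3) (E : Set (Set R3)) (x : R3 × R3) : Set R3 :=
  if h : ∃ U ∈ topComponents (Y V E), ∃ δ > 0, Metric.ball x.1 δ ∩ wedge E x ⊆ U
  then h.choose else ∅

theorem IsFan.dface_mem (h : IsFan V E) {x : R3 × R3} (hx : x ∈ darts V E) :
    dface V E x ∈ topComponents (Y V E) := by
  unfold dface
  rw [dif_pos (h.exists_face hx)]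
  exact (h.exists_face hx).choose_spec.1

theorem IsFan.dface_spec (h : IsFan V E) {x : R3 × R3} (hx : x ∈ darts V E) :
    ∃ δ > 0, Metric.ball x.1 δ ∩ wedge E x ⊆ dface V E x := by
  unfold dface
  rw [dif_pos (h.exists_face hx)]
  exact (h.exists_face hx).choose_spec.2

theorem IsFan.mem_dartsInto_iff (h : IsFan V E) {x : R3 × R3} {U : Set R3}
    (hU : U ∈ topComponents (Y V E)) :
    x ∈ dartsInto V E U ↔ x ∈ darts V E ∧ dface V E x = U := by
  constructor
  · rintro ⟨hx, hev⟩
    refine ⟨hx, ?_⟩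
    obtain ⟨δ, hδ, hsub⟩ := h.dface_spec hx
    obtain ⟨ε, ⟨p, ⟨hpU, hpb⟩, hpw⟩, hε⟩ :=
      (hev.and (Ioo_mem_nhdsGT hδ)).exists
    exact eq_of_mem_topComponents (h.dface_mem hx) hU
      (hsub ⟨Metric.ball_subset_ball hε.2.le hpb, hpw⟩) hpU
  · rintro ⟨hx, rfl⟩
    refine ⟨hx, ?_⟩
    obtain ⟨δ, hδ, hsub⟩ := h.dface_spec hx
    filter_upwards [Ioo_mem_nhdsGT hδ] with ε hε
    obtain ⟨p, hpb, hpw⟩ := nonempty_ball_inter_wedge h hx hε.1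
    exact ⟨p, ⟨hsub ⟨Metric.ball_subset_ball hε.2.le hpb, hpw⟩, hpb⟩, hpw⟩

theorem frequently_det3_pos {v w y : R3} (hc : cr v w ≠ 0) (hy : det3 v w y = 0) :
    ∃ᶠ p in 𝓝 y, 0 < det3 v w p := by
  have ht : Tendsto (fun t : ℝ => y + t • cr v w) (𝓝[>] 0) (𝓝 y) := by
    have : Continuous fun t : ℝ => y + t • cr v w := by fun_prop
    simpa using (this.tendsto 0).mono_left nhdsWithin_le_nhds
  refine ht.frequently (Eventually.frequently ?_)
  filter_upwards [self_mem_nhdsWithin] with t ht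
  have := det3_comb v w y (cr v w) 1 t
  rw [one_smul, hy, det3_cr, mul_zero, zero_add] at this
  rw [this]
  have ht : 0 < t := ht
  positivity

/-- There are points of the open arc from `v` to `w` arbitrarily close to `v`. -/
theorem exists_near (v w : R3) {δ : ℝ} (hδ : 0 < δ) :
    ∃ β : ℝ, 0 < β ∧ (1 : ℝ) • v + β • w ∈ Metric.ball v δ := by
  have hc : ContinuousAt (fun t : ℝ => (1 : ℝ) • v + t • w) 0 := by fun_prop
  have hev := (hc.eventually_mem (by
      rw [one_smul, zero_smul, add_zero]; exact Metric.ball_mem_nhds v hδ)).filter_mono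
      (nhdsWithin_le_nhds (s := Ioi 0))
  obtain ⟨t, ht, ht0⟩ := (hev.and self_mem_nhdsWithin).exists
  exact ⟨t, ht0, ht⟩

/-- The dart `(v, w)` leads into the face that lies to the left of the whole arc from `v` to
`w`. -/
theorem IsFan.eventually_mem_dface (h : IsFan V E) {v w : R3} (hw : w ∈ nbrs E v) {s t : ℝ}
    (hs : 0 < s) (ht : 0 < t) :
    ∀ᶠ p in 𝓝 (s • v + t • w), 0 < det3 v w p → p ∈ dface V E (v, w) := by
  have hc := h.cr_ne_zero hw
  have hx : (v, w) ∈ darts V E := Or.inl hw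
  obtain ⟨δ, hδ, hsub⟩ := h.dface_spec hx
  obtain ⟨β, hβ, hyb⟩ := exists_near v w hδ
  set x := s • v + t • w with hxdef
  set y := (1 : ℝ) • v + β • w with hydef
  set C := ⋃ ε ∈ E \ {{v, w}}, cone ε with hC
  have hCclosed : IsClosed C := (h.finite_edges.subset Set.sdiff_subset).isClosed_biUnion
    fun ε hε => h.isClosed_cone hε.1
  -- A thin neighbourhood of the part `[x, y]` of the arc meets no other blade, and its left half is
  -- a convex set that reaches into the wedge of the dart near `v`.
  have hseg : segment ℝ x y ⊆ Cᶜ := by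
    rintro p ⟨a, b, ha, hb, hab, rfl⟩ hp
    obtain ⟨ε, hε, hpε⟩ := Set.mem_iUnion₂.1 hp
    have e : a • x + b • y = (a * s + b * 1) • v + (a * t + b * β) • w := by
      rw [hxdef, hydef]; module
    rw [e] at hpε
    refine h.notMem_cone hw ?_ ?_ hε.1 hε.2 hpε
    · rcases ha.eq_or_lt with rfl | ha
      · have : b = 1 := by linarith
        rw [this]; norm_num
      · positivity
    · rcases ha.eq_or_lt with rfl | ha
      · have : b = 1 := by linarith
        rw [this]; simpa using hβ
      · positivity
  have hcomp : IsCompact (segment ℝ x y) := by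
    rw [segment_eq_image]
    exact isCompact_Icc.image (by fun_prop)
  obtain ⟨η, hη, hthick⟩ := hcomp.exists_thickening_subset_open hCclosed.isOpen_compl hseg
  have hconv : Convex ℝ (Metric.thickening η (segment ℝ x y) ∩ {p | 0 < det3 v w p}) := by
    refine ((convex_segment x y).thickening η).inter ?_
    intro p hp q hq a b ha hb hab
    change 0 < det3 v w _
    rw [det3_comb]
    have hp : 0 < det3 v w p := hp
    have hq : 0 < det3 v w q := hq
    rcases ha.eq_or_lt with rfl | ha
    · have : b = 1 := by linarith
      rw [this]; simpa using hq
    · positivity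
  have hY : Metric.thickening η (segment ℝ x y) ∩ {p | 0 < det3 v w p} ⊆ Y V E := by
    rintro p ⟨hp, hd⟩ hX
    obtain ⟨ε, hε, hpε⟩ := Set.mem_iUnion₂.1 hX
    by_cases he : ε = {v, w}
    · rw [he] at hpε
      obtain ⟨s', t', -, -, rfl⟩ := mem_cone_pair.1 hpε
      have hd : 0 < det3 v w _ := hd
      rw [det3_comb_self] at hd
      exact lt_irrefl _ hd
    · exact hthick hp (Set.mem_iUnion₂.2 ⟨ε, ⟨hε, he⟩, hpε⟩)
  have hyth : ∀ᶠ p in 𝓝 y, p ∈ Metric.thickening η (segment ℝ x y) :=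
    Metric.isOpen_thickening.eventually_mem
      (Metric.self_subset_thickening hη _ (right_mem_segment ℝ x y))
  have hmeet : ((Metric.thickening η (segment ℝ x y) ∩ {p | 0 < det3 v w p}) ∩
      dface V E (v, w)).Nonempty := by
    have hyd : det3 v w y = 0 := det3_comb_self _ _ _ _
    obtain ⟨p, hp1, hp2, hp3, hp4⟩ := ((frequently_det3_pos hc hyd).and_eventually
      (hyth.and ((Metric.isOpen_ball.eventually_mem hyb).and
      (eventually_azim_left hc hβ (h.theta_pos hw))))).exists
    refine ⟨p, ⟨hp2, hp1⟩, hsub ⟨hp3, ?_⟩⟩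
    rw [wedge_eq hw]
    exact hp4 hp1
  have hfin := subset_of_mem_topComponents (h.dface_mem hx) hconv.isPreconnected hY hmeet
  have hxth : ∀ᶠ p in 𝓝 x, p ∈ Metric.thickening η (segment ℝ x y) :=
    Metric.isOpen_thickening.eventually_mem
      (Metric.self_subset_thickening hη _ (left_mem_segment ℝ x y))
  filter_upwards [hxth] with p hp hd using hfin ⟨hp, hd⟩

/-- The face to the left of the dart `(v, u)` is the face to the right of the next edge at `v`. -/
theorem IsFan.dface_sigma (h : IsFan V E) {v u : R3} (hu : u ∈ nbrs E v) :
    dface V E (sigma E v u, v) = dface V E (v, u) := by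
  set w := sigma E v u with hwdef
  have hw : w ∈ nbrs E v := h.sigma_mem hu
  have hw' : v ∈ nbrs E w := mem_nbrs_comm.1 hw
  have cw := h.cr_ne_zero hw
  have cu := h.cr_ne_zero hu
  obtain ⟨δ, hδ, hsub⟩ := h.dface_spec (x := (v, u)) (Or.inl hu)
  obtain ⟨β, hβ, hyb⟩ := exists_near v w hδ
  have hside := h.eventually_mem_dface hw' hβ one_pos
  rw [add_comm] at hside
  have hyd : det3 w v ((1 : ℝ) • v + β • w) = 0 := by
    rw [det3_swap, det3_comb_self, neg_zero]
  obtain ⟨p, hp1, hp2, hp3, hp4⟩ := ((frequently_det3_pos (h.cr_ne_zero hw') hyd).and_eventually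
    (hside.and ((Metric.isOpen_ball.eventually_mem hyb).and
    (eventually_azim_right cw hβ (h.theta_pos hu))))).exists
  refine eq_of_mem_topComponents (h.dface_mem (Or.inl hw')) (h.dface_mem (Or.inl hu)) (hp2 hp1)
    (hsub ⟨hp3, ?_⟩)
  -- Just to the right of the arc to `w`, the azimuth from `u` is just below the angle of `(v, u)`.
  have hneg : det3 v w p < 0 := by rw [det3_swap] at hp1; linarith
  have hp5 := hp4 hneg
  rw [wedge_eq hu]
  have cp : cr v p ≠ 0 := cr_ne_zero_left hneg.ne
  by_cases hs : nbrs E v = {u}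
  · have hwu : w = u := by
      rw [hs] at hw
      exact hw
    have hθ : theta E v u = 2 * Real.pi := if_pos hs
    rw [hθ, hwu] at hp5
    rw [hθ]
    exact ⟨by linarith, hp5.2⟩
  · have hθ : theta E v u = azim v u w := if_neg hs
    rw [hθ] at hp5
    rw [hθ]
    have := azim_add_of_le cu cw cp (by linarith)
    change 0 < azim v u p ∧ azim v u p < _
    rw [this]
    constructor <;> linarith

/-! ### Functions on the faces and their jumps across the edges -/

theorem connectedComponentIn_eq_of_mem {A U : Set R3} (hU : U ∈ topComponents A) {p : R3}
    (hp : p ∈ U) : connectedComponentIn A p = U := by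
  obtain ⟨a, ha, rfl⟩ := hU
  exact (connectedComponentIn_eq hp).symm

theorem subset_of_topComponents {A U : Set R3} (hU : U ∈ topComponents A) : U ⊆ A := by
  obtain ⟨a, ha, rfl⟩ := hU
  exact connectedComponentIn_subset A a

theorem nonempty_of_topComponents {A U : Set R3} (hU : U ∈ topComponents A) : U.Nonempty := by
  obtain ⟨a, ha, rfl⟩ := hU
  exact ⟨a, mem_connectedComponentIn ha⟩

theorem IsFan.isOpen_face (h : IsFan V E) {U : Set R3} (hU : U ∈ topComponents (Y V E)) :
    IsOpen U := by
  obtain ⟨a, ha, rfl⟩ := hU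
  exact h.isOpen_Y.connectedComponentIn

theorem IsFan.exists_ends (h : IsFan V E) :
    ∃ a b : E → R3, ∀ ε : E, (ε : Set R3) = {a ε, b ε} := by
  have : ∀ ε : E, ∃ a b, (ε : Set R3) = {a, b} := fun ε => by
    obtain ⟨a, -, b, -, -, e⟩ := h.edges _ ε.2
    exact ⟨a, b, e⟩
  choose a b hab using this
  exact ⟨a, b, hab⟩

theorem IsFan.dense_Y (h : IsFan V E) : Dense (Y V E) := by
  obtain ⟨a, b, hab⟩ := h.exists_ends
  have : Finite E := h.finite_edges
  refine (isOpen_dense_of_finite a b fun ε => ?_).2.mono ?_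
  · exact h.cr_ne_zero (by rw [← hab]; exact ε.2)
  · intro p hp hX
    obtain ⟨ε, hε, hpε⟩ := Set.mem_iUnion₂.1 hX
    have e := hab ⟨ε, hε⟩
    simp only at e
    rw [e] at hpε
    obtain ⟨s, t, -, -, rfl⟩ := mem_cone_pair.1 hpε
    exact hp ⟨ε, hε⟩ (det3_comb_self _ _ _ _)

/-- A function on the faces without jumps across the edges is constant: two faces can be joined
by a segment that crosses blades only in their relative interiors. -/
theorem IsFan.face_const (h : IsFan V E) {α : Type*} {g : Set R3 → α}
    (hg : ∀ v, ∀ w ∈ nbrs E v, g (dface V E (v, w)) = g (dface V E (w, v)))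
    {U U' : Set R3} (hU : U ∈ topComponents (Y V E)) (hU' : U' ∈ topComponents (Y V E)) :
    g U = g U' := by
  have hfin : Finite V := h.finite
  have hv0 : ∀ v : V, (v : R3) ≠ 0 := fun v h0 => h.origin (h0 ▸ v.2)
  choose e he using fun v : V => exists_cr_ne_zero (hv0 v)
  have d1 := isOpen_dense_of_finite (fun v : V => (v : R3)) e he
  obtain ⟨p, hpU, hpd⟩ := d1.2.inter_open_nonempty U (h.isOpen_face hU)
    (nonempty_of_topComponents hU)
  have hpc : ∀ v : V, cr (v : R3) p ≠ 0 := fun v => cr_ne_zero_left (hpd v)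
  have d2 := isOpen_dense_of_finite (fun _ : V => p) (fun v : V => (v : R3)) fun v => by
    rw [cr_swap]; simpa using hpc v
  obtain ⟨q, hqU, hqd⟩ := d2.2.inter_open_nonempty U' (h.isOpen_face hU')
    (nonempty_of_topComponents hU')
  have hqd : ∀ v : V, det3 p v q ≠ 0 := hqd
  -- In general position, the segment from `p` to `q` meets no line through the origin and a node.
  have havoid : ∀ x ∈ segment ℝ p q, ∀ v ∈ V, ∀ c : ℝ, x ≠ c • v := by
    rintro x ⟨a, b, ha, hb, hab, rfl⟩ v hv c hx
    have h1 := det3_comb p v p q a b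
    rw [hx, det3_self_left, mul_zero, zero_add] at h1
    have h2 := det3_comb_self p v 0 c
    rw [zero_smul, zero_add] at h2
    rw [h2] at h1
    have hb0 : b = 0 := (mul_eq_zero.1 h1.symm).resolve_right (hqd ⟨v, hv⟩)
    have ha1 : a = 1 := by linarith
    rw [hb0, ha1, one_smul, zero_smul, add_zero] at hx
    apply hpc ⟨v, hv⟩
    rw [hx]
    apply ext3 <;> simp only [PiLp.smul_apply, smul_eq_mul, cr_zero, cr_one, cr_two,
      PiLp.zero_apply] <;> ring
  obtain ⟨c, hc⟩ := exists_const_of_locally_const h.dense_Y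
    (fun p => g (connectedComponentIn (Y V E) p)) (convex_segment p q).isPreconnected
    ⟨p, left_mem_segment ℝ p q⟩ (by
      intro x hx
      by_cases hxY : x ∈ Y V E
      · refine ⟨g (connectedComponentIn (Y V E) x), ?_⟩
        rw [eventually_nhdsWithin_iff]
        filter_upwards [(h.isOpen_face ⟨x, hxY, rfl⟩).eventually_mem
          (mem_connectedComponentIn hxY)] with y hy _
        rw [connectedComponentIn_eq hy]
      · rw [Y, Set.notMem_compl_iff] at hxY
        obtain ⟨ε, hε, hxε⟩ := Set.mem_iUnion₂.1 hxY
        obtain ⟨v, hv, w, hw, -, rfl⟩ := h.edges _ hε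
        obtain ⟨s, t, hs, ht, hxe⟩ := mem_cone_pair.1 hxε
        have hs' : 0 < s := by
          refine lt_of_le_of_ne hs ?_
          rintro rfl
          exact havoid x hx w hw t (by rw [hxe, zero_smul, zero_add])
        have ht' : 0 < t := by
          refine lt_of_le_of_ne ht ?_
          rintro rfl
          exact havoid x hx v hv s (by rw [hxe, zero_smul, add_zero])
        have hcr := h.cr_ne_zero hε
        have hN : 0 < ‖cr v w‖ ^ 2 := by positivity
        have hw' : w ∈ nbrs E v := hε
        refine ⟨g (dface V E (v, w)), ?_⟩
        rw [eventually_nhdsWithin_iff]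
        -- Points near `x` lie on the blade, or in the face to the left or to the right of it.
        have hA : 0 < coefA v w x := by rw [hxe, coefA_comb]; positivity
        have hB : 0 < coefB v w x := by rw [hxe, coefB_comb]; positivity
        have e1 := h.eventually_mem_dface hw' hs' ht'
        have e2 := h.eventually_mem_dface (mem_nbrs_comm.1 hw') ht' hs'
        rw [add_comm] at e2
        rw [← hxe] at e1 e2
        filter_upwards [e1, e2,
          (continuous_coefA v w).continuousAt.eventually_const_lt hA,
          (continuous_coefB v w).continuousAt.eventually_const_lt hB] with y y1 y2 y3 y4 hyY
        rcases lt_trichotomy (det3 v w y) 0 with hd | hd | hd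
        · rw [det3_swap] at y2
          rw [connectedComponentIn_eq_of_mem (h.dface_mem (Or.inl (mem_nbrs_comm.1 hw')))
            (y2 (by linarith)), hg v w hw']
        · exfalso
          refine hyY (Set.mem_iUnion₂.2 ⟨_, hε, ?_⟩)
          rw [cone_pair_eq hcr]
          exact ⟨hd, y3.le, y4.le⟩
        · rw [connectedComponentIn_eq_of_mem (h.dface_mem (Or.inl hw')) (y1 hd)])
  have hp := (hc p (left_mem_segment ℝ p q)).self_of_nhdsWithin (subset_of_topComponents hU hpU)
  have hq := (hc q (right_mem_segment ℝ p q)).self_of_nhdsWithin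
    (subset_of_topComponents hU' hqU)
  rw [connectedComponentIn_eq_of_mem hU hpU] at hp
  rw [connectedComponentIn_eq_of_mem hU' hqU] at hq
  rw [hp, hq]

theorem exists_dart_at {v : R3} (hv : v ∈ V) : ∃ w, (v, w) ∈ darts V E := by
  by_cases hn : nbrs E v = ∅
  · exact ⟨v, Or.inr ⟨hv, hn, rfl⟩⟩
  · obtain ⟨w, hw⟩ := Set.nonempty_iff_ne_empty.2 hn
    exact ⟨w, Or.inl hw⟩

theorem IsFan.fst_mem (h : IsFan V E) {x : R3 × R3} (hx : x ∈ darts V E) : x.1 ∈ V := by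
  rcases hx with hx | hx
  · exact (h.edge_mem hx).1
  · exact hx.1

/-- Every face has a dart that leads into it; otherwise its indicator would be a nonconstant
function without jumps. -/
theorem IsFan.exists_dface_eq (h : IsFan V E) {U : Set R3} (hU : U ∈ topComponents (Y V E)) :
    ∃ x ∈ darts V E, dface V E x = U := by
  by_contra! hn
  obtain ⟨v, hv⟩ := h.nonempty
  obtain ⟨w, hx⟩ := exists_dart_at (E := E) hv
  have := h.face_const (g := fun W => W = U) (fun v w hw => by
    rw [eq_iff_iff]
    exact ⟨fun h' => absurd h' (hn _ (Or.inl hw)),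
      fun h' => absurd h' (hn _ (Or.inl (mem_nbrs_comm.1 hw)))⟩) hU (h.dface_mem hx)
  exact hn _ hx (cast this rfl)

theorem IsFan.finite_darts (h : IsFan V E) : (darts V E).Finite := by
  refine (h.finite.prod h.finite).subset ?_
  rintro ⟨v, w⟩ (hx | ⟨h1, -, h3⟩)
  · exact ⟨(h.edge_mem hx).1, (h.edge_mem hx).2.1⟩
  · exact ⟨h1, h3 ▸ h1⟩

theorem IsFan.finite_faces (h : IsFan V E) : (topComponents (Y V E)).Finite := by
  refine (h.finite_darts.image (dface V E)).subset fun U hU => ?_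
  obtain ⟨x, hx, rfl⟩ := h.exists_dface_eq hU
  exact ⟨x, hx, rfl⟩

/-- Points of a dense set `D` can be found arbitrarily close to a point `x` of the plane of `v` and
`w` on the positive side of this plane. -/
theorem exists_dense_near {D : Set R3} (hD : Dense D) {v w x : R3} (hc : cr v w ≠ 0)
    (hx : det3 v w x = 0) {P : R3 → Prop} (hP : ∀ᶠ p in 𝓝 x, P p) :
    ∃ p ∈ D, 0 < det3 v w p ∧ P p := by
  obtain ⟨p0, hp0, hev⟩ :=
    ((frequently_det3_pos hc hx).and_eventually (eventually_eventually_nhds.2 hP)).exists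
  have hpos : ∀ᶠ p in 𝓝 p0, 0 < det3 v w p :=
    (continuous_det3 continuous_const continuous_const
      continuous_id).continuousAt.eventually_const_lt hp0
  obtain ⟨p, hpD, hp1, hp2⟩ := hD.inter_nhds_nonempty (hpos.and hev)
  exact ⟨p, hpD, hp1, hp2⟩

/-- Every even set of edges is the set of edges across which some function on the faces jumps. -/
theorem IsFan.exists_jump (h : IsFan V E) [Fintype E] {a b : E → R3}
    (hab : ∀ ε : E, (ε : Set R3) = {a ε, b ε}) (z : E → ZMod 2)
    (hz : ∀ f : R3 → ZMod 2, ∑ ε, z ε * (f (a ε) + f (b ε)) = 0) :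
    ∃ g : Set R3 → ZMod 2, ∀ ε : E,
      g (dface V E (a ε, b ε)) + g (dface V E (b ε, a ε)) = z ε := by
  have hmem : ∀ ε : E, b ε ∈ nbrs E (a ε) := fun ε => by rw [mem_nbrs, ← hab]; exact ε.2
  have hcr : ∀ ε : E, cr (a ε) (b ε) ≠ 0 := fun ε => h.cr_ne_zero (hmem ε)
  obtain ⟨f, D, hD, hf1, hf2⟩ := exists_parity_function hcr hz
  have hface : ∀ U ∈ topComponents (Y V E), ∃ c, ∀ x ∈ U, x ∈ D → f x = c := by
    intro U hU
    have hpre : IsPreconnected U := by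
      obtain ⟨p, hp, rfl⟩ := hU
      exact isPreconnected_connectedComponentIn
    obtain ⟨c, hc⟩ := exists_const_of_locally_const hD f hpre (nonempty_of_topComponents hU)
      fun x hx => hf1 x fun ε _ hxε =>
        subset_of_topComponents hU hx (Set.mem_iUnion₂.2 ⟨_, ε.2, by rw [hab]; exact hxε⟩)
    exact ⟨c, fun x hx hxD => (hc x hx).self_of_nhdsWithin hxD⟩
  have hface' : ∀ U, ∃ c, U ∈ topComponents (Y V E) → ∀ x ∈ U, x ∈ D → f x = c := by
    intro U
    by_cases hU : U ∈ topComponents (Y V E)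
    · obtain ⟨c, hc⟩ := hface U hU
      exact ⟨c, fun _ => hc⟩
    · exact ⟨0, fun h' => absurd h' hU⟩
  choose g hg using hface'
  refine ⟨g, fun ε => ?_⟩
  have hm := hmem ε
  have hm' : a ε ∈ nbrs E (b ε) := mem_nbrs_comm.1 hm
  set x := (1 : ℝ) • a ε + (1 : ℝ) • b ε with hx
  have hjump : ∃ c c', c + c' = z ε ∧ (∀ᶠ p in 𝓝[D] x, 0 < det3 (a ε) (b ε) p → f p = c) ∧
      (∀ᶠ p in 𝓝[D] x, det3 (a ε) (b ε) p < 0 → f p = c') := by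
    have hoff : ∀ j : E, j ≠ ε → x ∉ cone {a j, b j} := fun j hj => by
      rw [← hab]
      refine h.notMem_cone hm one_pos one_pos j.2 ?_
      rw [← hab]
      exact fun h' => hj (Subtype.ext h')
    by_cases hzε : z ε = 0
    · obtain ⟨c, hc⟩ := hf1 x fun j hj => hoff j (by rintro rfl; exact hj hzε)
      refine ⟨c, c, by rw [hzε, CharTwo.add_self_eq_zero], ?_, ?_⟩
      · filter_upwards [hc] with p hp _ using hp
      · filter_upwards [hc] with p hp _ using hp
    · obtain ⟨c, hc1, hc2⟩ := hf2 ε x hzε ⟨1, 1, one_pos, one_pos, rfl⟩ fun j hj _ => hoff j hj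
      refine ⟨c + 1, c, ?_, hc1, hc2⟩
      generalize z ε = y at hzε
      have : ∀ c y : ZMod 2, y ≠ 0 → c + 1 + c = y := by decide
      exact this c y hzε
  obtain ⟨c, c', hcc, hc, hc'⟩ := hjump
  rw [eventually_nhdsWithin_iff] at hc hc'
  have e1 := h.eventually_mem_dface hm one_pos one_pos
  have e2 := h.eventually_mem_dface hm' one_pos one_pos
  rw [add_comm] at e2
  have hx0 : det3 (a ε) (b ε) x = 0 := det3_comb_self _ _ _ _
  obtain ⟨p, hpD, hp0, hp1, hp2⟩ := exists_dense_near hD (hcr ε) hx0 (hc.and e1)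
  obtain ⟨q, hqD, hq0, hq1, hq2⟩ := exists_dense_near hD (h.cr_ne_zero hm')
    (by rw [det3_swap, hx0, neg_zero]) (hc'.and e2)
  rw [← hcc, ← hp1 hpD hp0, ← hq1 hqD (by rw [det3_swap] at hq0; linarith),
    hg _ (h.dface_mem (Or.inl hm)) p (hp2 hp0) hpD,
    hg _ (h.dface_mem (Or.inl hm')) q (hq2 hq0) hqD]

theorem IsFan.finite_darts1 (h : IsFan V E) : (darts1 V E).Finite :=
  h.finite_darts.subset Set.subset_union_left

/-- Each edge carries two nonisolated darts. -/
theorem IsFan.sum_darts1 (h : IsFan V E) [Fintype E] {a b : E → R3}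
    (hab : ∀ ε : E, (ε : Set R3) = {a ε, b ε}) {M : Type*} [AddCommMonoid M] (F : R3 × R3 → M) :
    ∑ x ∈ h.finite_darts1.toFinset, F x = ∑ ε : E, (F (a ε, b ε) + F (b ε, a ε)) := by
  have hmem : ∀ ε : E, b ε ∈ nbrs E (a ε) := fun ε => by rw [mem_nbrs, ← hab]; exact ε.2
  have hne : ∀ ε : E, a ε ≠ b ε := fun ε => (h.edge_mem (hmem ε)).2.2
  have e : ∑ ε : E, (F (a ε, b ε) + F (b ε, a ε)) =
      ∑ y : E × Bool, F (if y.2 = true then (a y.1, b y.1) else (b y.1, a y.1)) := by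
    rw [Fintype.sum_prod_type]
    simp
  rw [e]
  symm
  refine Finset.sum_bij (fun y _ => if y.2 = true then (a y.1, b y.1) else (b y.1, a y.1))
    ?_ ?_ ?_ fun _ _ => rfl
  · rintro ⟨ε, i⟩ -
    rw [Set.Finite.mem_toFinset]
    cases i
    · exact mem_nbrs_comm.1 (hmem ε)
    · exact hmem ε
  · rintro ⟨ε, i⟩ - ⟨ε', i'⟩ - heq
    have hε : ε = ε' := by
      apply Subtype.ext
      rw [hab, hab]
      cases i <;> cases i' <;> simp only [Bool.false_eq_true, if_true, if_false,
        Prod.mk.injEq] at heq <;> obtain ⟨h1, h2⟩ := heq <;> rw [h1, h2]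
      · exact Set.pair_comm _ _
      · exact Set.pair_comm _ _
    subst hε
    cases i <;> cases i' <;> simp only [Bool.false_eq_true, if_true, if_false,
        Prod.mk.injEq] at heq ⊢
    · exact absurd heq.2 (hne ε)
    · exact absurd heq.1 (hne ε)
  · rintro ⟨v, w⟩ hx
    rw [Set.Finite.mem_toFinset] at hx
    have hx : ({v, w} : Set R3) ∈ E := hx
    have e := hab ⟨_, hx⟩
    simp only at e
    rcases Set.pair_eq_pair_iff.1 e with ⟨h1, h2⟩ | ⟨h1, h2⟩
    · exact ⟨(⟨_, hx⟩, true), Finset.mem_univ _, by simp [← h1, ← h2]⟩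
    · exact ⟨(⟨_, hx⟩, false), Finset.mem_univ _, by simp [← h1, ← h2]⟩

/-- The jumps of a function on the faces form an even set of edges: around a node, each face
between consecutive edges contributes twice. -/
theorem IsFan.sum_jump (h : IsFan V E) [Fintype E] {a b : E → R3}
    (hab : ∀ ε : E, (ε : Set R3) = {a ε, b ε}) {G : R3 × R3 → ZMod 2}
    (hG : ∀ v, ∀ u ∈ nbrs E v, G (sigma E v u, v) = G (v, u)) (f : R3 → ZMod 2) :
    ∑ ε : E, (G (a ε, b ε) + G (b ε, a ε)) * (f (a ε) + f (b ε)) = 0 := by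
  have e1 : ∑ ε : E, (G (a ε, b ε) + G (b ε, a ε)) * (f (a ε) + f (b ε)) =
      ∑ x ∈ h.finite_darts1.toFinset, (G x + G (x.2, x.1)) * f x.1 := by
    rw [h.sum_darts1 hab]
    exact Finset.sum_congr rfl fun ε _ => by ring
  -- Reindex by the node map, which is a permutation of the nonisolated darts.
  have e2 : ∑ x ∈ h.finite_darts1.toFinset, G (x.2, x.1) * f x.1 =
      ∑ x ∈ h.finite_darts1.toFinset, G x * f x.1 := by
    symm
    refine Finset.sum_bij (fun x _ => (x.1, sigma E x.1 x.2)) ?_ ?_ ?_ ?_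
    · intro x hx
      rw [Set.Finite.mem_toFinset] at hx ⊢
      exact h.sigma_mem hx
    · rintro ⟨v, w⟩ hx ⟨v', w'⟩ hx' heq
      rw [Set.Finite.mem_toFinset] at hx hx'
      simp only [Prod.mk.injEq] at heq
      obtain ⟨rfl, heq⟩ := heq
      exact Prod.ext rfl (h.sigma_injOn v hx hx' heq)
    · rintro ⟨v, w⟩ hx
      rw [Set.Finite.mem_toFinset] at hx
      obtain ⟨u, hu, hσ⟩ := (h.sigma_bijOn v).surjOn hx
      exact ⟨(v, u), (Set.Finite.mem_toFinset _).2 hu, by simp only [hσ]⟩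
    · rintro ⟨v, u⟩ hx
      rw [Set.Finite.mem_toFinset] at hx
      simp only
      rw [hG v u hx]
  rw [e1]
  simp only [add_mul]
  rw [Finset.sum_add_distrib, e2, CharTwo.add_self_eq_zero]

/-! ### Combinatorial components -/

/-- The combinatorial component of a dart. -/
def cls (V : Set R3) (E : Set (Set R3)) (x : R3 × R3) : Set (R3 × R3) :=
  {y | y ∈ darts V E ∧ Relation.EqvGen (hypStep V E) x y}

theorem cls_eq_of_eqvGen {x y : R3 × R3} (hxy : Relation.EqvGen (hypStep V E) x y) :
    cls V E x = cls V E y := by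
  ext z
  exact ⟨fun hz => ⟨hz.1, (hxy.symm _ _).trans _ _ _ hz.2⟩, fun hz => ⟨hz.1, hxy.trans _ _ _ hz.2⟩⟩

theorem mem_cls_self {x : R3 × R3} (hx : x ∈ darts V E) : x ∈ cls V E x :=
  ⟨hx, Relation.EqvGen.refl x⟩

theorem eqvGen_of_cls_eq {x y : R3 × R3} (hy : y ∈ darts V E) (hxy : cls V E x = cls V E y) :
    Relation.EqvGen (hypStep V E) x y := by
  have := mem_cls_self hy
  rw [← hxy] at this
  exact this.2

theorem cls_edge {v w : R3} (hw : w ∈ nbrs E v) : cls V E (v, w) = cls V E (w, v) :=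
  cls_eq_of_eqvGen (.rel _ _ ⟨Or.inl hw, Or.inl (mem_nbrs_comm.1 hw), Or.inl rfl⟩)

theorem IsFan.cls_sigma (h : IsFan V E) {v w : R3} (hw : w ∈ nbrs E v) :
    cls V E (v, sigma E v w) = cls V E (v, w) := by
  refine (cls_eq_of_eqvGen (.rel _ _
    ⟨Or.inl hw, Or.inl (h.sigma_mem hw), Or.inr (Or.inl ?_)⟩)).symm
  unfold nodeMap
  rw [if_neg]
  exact (h.edge_mem hw).2.2.symm

theorem IsFan.cls_node (h : IsFan V E) {v u w : R3} (hw : w ∈ nbrs E v) (hu : u ∈ nbrs E v) :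
    cls V E (v, u) = cls V E (v, w) := by
  have := h.sigma_transitive (S := {u | u ∈ nbrs E v ∧ cls V E (v, u) = cls V E (v, w)})
    (fun u hu => hu.1) ⟨hw, rfl⟩ fun u hu => ⟨h.sigma_mem hu.1, (h.cls_sigma hu.1).trans hu.2⟩
  rw [← this] at hu
  exact hu.2

theorem IsFan.cls_fst (h : IsFan V E) {x y : R3 × R3} (hx : x ∈ darts V E) (hy : y ∈ darts V E)
    (hxy : x.1 = y.1) : cls V E x = cls V E y := by
  obtain ⟨v, w⟩ := x
  obtain ⟨v', w'⟩ := y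
  simp only at hxy
  subst hxy
  rcases hx with hx | ⟨-, hx1, hx2⟩ <;> rcases hy with hy | ⟨-, hy1, hy2⟩
  · exact h.cls_node hy hx
  · exact absurd (show w ∈ nbrs E v from hx) (by simp only at hy1; rw [hy1]; exact id)
  · exact absurd (show w' ∈ nbrs E v from hy) (by simp only at hx1; rw [hx1]; exact id)
  · simp only at hx2 hy2
    rw [hx2, hy2]

/-- A function on the darts that is invariant under the edge and node maps is constant on the
combinatorial components. -/
theorem IsFan.eq_of_cls_eq (h : IsFan V E) {α : Type*} {φ : R3 × R3 → α}
    (h1 : ∀ v, ∀ w ∈ nbrs E v, φ (v, w) = φ (w, v))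
    (h2 : ∀ v, ∀ w ∈ nbrs E v, φ (v, sigma E v w) = φ (v, w))
    {x y : R3 × R3} (hy : y ∈ darts V E) (hxy : cls V E x = cls V E y) : φ x = φ y := by
  have hE := eqvGen_of_cls_eq hy hxy
  clear hxy hy
  induction hE with
  | refl => rfl
  | symm _ _ _ ih => exact ih.symm
  | trans _ _ _ _ _ ih1 ih2 => exact ih1.trans ih2
  | rel x y hstep =>
    obtain ⟨hx, -, hstep⟩ := hstep
    obtain ⟨v, w⟩ := x
    rcases hx with hx | ⟨-, -, hwv⟩
    · have hw : w ∈ nbrs E v := hx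
      have hne : w ≠ v := (h.edge_mem hw).2.2.symm
      rcases hstep with rfl | rfl | rfl
      · exact h1 v w hw
      · rw [nodeMap, if_neg hne]
        exact (h2 v w hw).symm
      · rw [faceMap, if_neg hne]
        have hv : v ∈ sigma E w '' nbrs E w := (h.sigma_bijOn w).surjOn (mem_nbrs_comm.1 hw)
        have hu := Function.invFunOn_mem hv
        have hσ := Function.invFunOn_eq hv
        simp only at hu hσ ⊢
        have := h2 w _ hu
        rw [hσ] at this
        rw [← this, h1 v w hw]
    · simp only at hwv
      subst w
      rcases hstep with rfl | rfl | rfl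
      · rfl
      · rw [nodeMap, if_pos rfl]
      · rw [faceMap, if_pos rfl]

/-! ### Counting by linear algebra modulo two -/

/-- The dimension of the orthogonal complement of the range of a linear map. -/
theorem finrank_orthogonal_range {X W : Type*} [Fintype X] [Fintype W]
    (L : (X → ZMod 2) →ₗ[ZMod 2] (W → ZMod 2)) (Z : Submodule (ZMod 2) (W → ZMod 2))
    (hZ : ∀ z, z ∈ Z ↔ ∀ f, ∑ w, z w * L f w = 0) :
    Module.finrank (ZMod 2) Z + Module.finrank (ZMod 2) (LinearMap.range L) = Fintype.card W := by
  classical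
  set M := LinearMap.toMatrix' L with hM
  have hL : ∀ f, L f = M.mulVec f := fun f => by
    rw [hM, LinearMap.toMatrix'_mulVec]
  have e : Z = LinearMap.ker M.transpose.mulVecLin := by
    ext z
    rw [hZ, LinearMap.mem_ker, Matrix.mulVecLin_apply]
    have : ∀ f, ∑ w, z w * L f w = M.transpose.mulVec z ⬝ᵥ f := fun f => by
      rw [hL, Matrix.mulVec_transpose, ← Matrix.dotProduct_mulVec]; rfl
    simp only [this]
    constructor
    · intro hz
      exact dotProduct_eq_zero _ hz
    · intro hz f
      rw [hz, zero_dotProduct]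
  have e2 : LinearMap.range L = LinearMap.range M.mulVecLin := by
    congr 1
    refine LinearMap.ext fun f => ?_
    rw [Matrix.mulVecLin_apply, hL]
  have h3 := LinearMap.finrank_range_add_finrank_ker M.transpose.mulVecLin
  rw [Module.finrank_fintype_fun_eq_card] at h3
  have h4 : Module.finrank (ZMod 2) (LinearMap.range M.transpose.mulVecLin) =
      Module.finrank (ZMod 2) (LinearMap.range M.mulVecLin) := M.rank_transpose
  rw [e, e2, ← h4, add_comm]
  exact h3

/-- The linear map that adds the values of a function at two points assigned to each edge. -/
def pairSum {X W : Type*} (l r : W → X) : (X → ZMod 2) →ₗ[ZMod 2] (W → ZMod 2) where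
  toFun f w := f (l w) + f (r w)
  map_add' f g := by ext w; simp only [Pi.add_apply]; ring
  map_smul' c f := by ext w; simp only [Pi.smul_apply, smul_eq_mul, RingHom.id_apply]; ring

theorem pairSum_apply {X W : Type*} (l r : W → X) (f : X → ZMod 2) (w : W) :
    pairSum l r f w = f (l w) + f (r w) := rfl

theorem zmod_two_add_eq_zero {x y : ZMod 2} : x + y = 0 ↔ x = y := by
  revert x y; decide

/-- If the points `l w` and `r w` generate an equivalence relation whose classes are the fibres of
a surjection `p` to `K`, then the kernel of `pairSum l r` has dimension `|K|`. -/
theorem finrank_ker_pairSum {X K W : Type*} [Fintype X] [Fintype K] (l r : W → X) (p : X → K)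
    (hp : Function.Surjective p) (h1 : ∀ w, p (l w) = p (r w))
    (h2 : ∀ f : X → ZMod 2, (∀ w, f (l w) = f (r w)) → ∀ x y, p x = p y → f x = f y) :
    Module.finrank (ZMod 2) (LinearMap.ker (pairSum l r)) = Fintype.card K := by
  have e : LinearMap.ker (pairSum l r) =
      LinearMap.range (LinearMap.funLeft (ZMod 2) (ZMod 2) p) := by
    ext f
    rw [LinearMap.mem_ker, LinearMap.mem_range]
    constructor
    · intro hf
      refine ⟨fun k => f (Function.surjInv hp k), ?_⟩
      ext x
      refine h2 f (fun w => ?_) _ _ (Function.surjInv_eq hp (p x))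
      have := congrFun hf w
      rwa [pairSum_apply, Pi.zero_apply, zmod_two_add_eq_zero] at this
    · rintro ⟨g, rfl⟩
      ext w
      rw [pairSum_apply, Pi.zero_apply, zmod_two_add_eq_zero, LinearMap.funLeft_apply,
        LinearMap.funLeft_apply, h1]
  rw [e, LinearMap.finrank_range_of_inj (LinearMap.funLeft_injective_of_surjective _ _ p hp),
    Module.finrank_fintype_fun_eq_card]

/-- Rank–nullity for two maps into the same space, when the range of one is the orthogonal
complement of the range of the other. -/
theorem card_add_card_of_orthogonal {X N W : Type*} [Fintype X] [Fintype N] [Fintype W]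
    (l r : W → X) (a b : W → N)
    (h : ∀ z : W → ZMod 2, (∃ g : X → ZMod 2, ∀ w, g (l w) + g (r w) = z w) ↔
      ∀ f : N → ZMod 2, ∑ w, z w * (f (a w) + f (b w)) = 0) :
    Fintype.card X + Fintype.card N =
      Module.finrank (ZMod 2) (LinearMap.ker (pairSum l r)) + Fintype.card W +
        Module.finrank (ZMod 2) (LinearMap.ker (pairSum a b)) := by
  have d0 := finrank_orthogonal_range (pairSum a b) (LinearMap.range (pairSum l r)) fun z => by
    rw [LinearMap.mem_range]
    refine Iff.trans ⟨?_, ?_⟩ (h z)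
    · rintro ⟨g, rfl⟩
      exact ⟨g, fun w => rfl⟩
    · rintro ⟨g, hg⟩
      exact ⟨g, funext hg⟩
  have d1 := LinearMap.finrank_range_add_finrank_ker (pairSum a b)
  have d2 := LinearMap.finrank_range_add_finrank_ker (pairSum l r)
  rw [Module.finrank_fintype_fun_eq_card] at d1 d2
  omega

theorem exists_extension {T : Type*} {S : Set T} (f : S → ZMod 2) :
    ∃ F : T → ZMod 2, ∀ s : S, f s = F s :=
  ⟨Function.extend Subtype.val f 0, fun s => (Subtype.val_injective.extend_apply f 0 s).symm⟩

/-- The incident pairs of a face and a combinatorial component: a dart of the component leads into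
the face. -/
def incidences (V : Set R3) (E : Set (Set R3)) : Set (Set R3 × Set (R3 × R3)) :=
  (fun x => (dface V E x, cls V E x)) '' darts V E

theorem combComponents_eq : combComponents V E = cls V E '' darts V E := by
  ext K
  constructor
  · rintro ⟨x, hx, rfl⟩; exact ⟨x, hx, rfl⟩
  · rintro ⟨x, hx, rfl⟩; exact ⟨x, hx, rfl⟩

theorem IsFan.finite_combComponents (h : IsFan V E) : (combComponents V E).Finite := by
  rw [combComponents_eq]; exact h.finite_darts.image _

theorem IsFan.finite_incidences (h : IsFan V E) : (incidences V E).Finite :=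
  h.finite_darts.image _

theorem fintype_card_eq_ncard {T : Type*} (S : Set T) [Fintype S] : Fintype.card S = S.ncard := by
  rw [← Nat.card_coe_set_eq, Nat.card_eq_fintype_card]

section Count

variable {a b : E → R3}

theorem mem_nbrs_of_ends (hab : ∀ ε : E, (ε : Set R3) = {a ε, b ε}) (ε : E) :
    b ε ∈ nbrs E (a ε) := by
  rw [mem_nbrs, ← hab]; exact ε.2

theorem mem_nbrs_of_ends' (hab : ∀ ε : E, (ε : Set R3) = {a ε, b ε}) (ε : E) :
    a ε ∈ nbrs E (b ε) := mem_nbrs_comm.1 (mem_nbrs_of_ends hab ε)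

/-- To verify a symmetric property of all darts, it suffices to consider one dart for each
edge. -/
theorem forall_nbrs_of_ends (hab : ∀ ε : E, (ε : Set R3) = {a ε, b ε}) {α : Type*}
    {φ : R3 × R3 → α} (hφ : ∀ ε, φ (a ε, b ε) = φ (b ε, a ε)) :
    ∀ v, ∀ w ∈ nbrs E v, φ (v, w) = φ (w, v) := by
  intro v w hw
  obtain ⟨ε, hε⟩ : ∃ ε : E, ({v, w} : Set R3) = ε := ⟨⟨_, hw⟩, rfl⟩
  rw [hab] at hε
  rcases Set.pair_eq_pair_iff.1 hε with ⟨rfl, rfl⟩ | ⟨rfl, rfl⟩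
  · exact hφ _
  · exact (hφ _).symm

theorem IsFan.cls_sigma' (h : IsFan V E) {v w : R3} (hw : w ∈ nbrs E v) :
    cls V E (sigma E v w, v) = cls V E (v, w) := by
  rw [← cls_edge (h.sigma_mem hw), h.cls_sigma hw]

/-- The end `a ε` of an edge as a node of the fan. -/
def IsFan.endA (h : IsFan V E) (hab : ∀ ε : E, (ε : Set R3) = {a ε, b ε}) (ε : E) : V :=
  ⟨a ε, (h.edge_mem (mem_nbrs_of_ends hab ε)).1⟩

/-- The end `b ε` of an edge as a node of the fan. -/
def IsFan.endB (h : IsFan V E) (hab : ∀ ε : E, (ε : Set R3) = {a ε, b ε}) (ε : E) : V :=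
  ⟨b ε, (h.edge_mem (mem_nbrs_of_ends hab ε)).2.1⟩

/-- The functions on the nodes with vanishing coboundary are the functions of the combinatorial
component. -/
theorem IsFan.finrank_ker_coboundary [Fintype V] (h : IsFan V E)
    (hab : ∀ ε : E, (ε : Set R3) = {a ε, b ε}) :
    Module.finrank (ZMod 2) (LinearMap.ker (pairSum (h.endA hab) (h.endB hab))) =
      (combComponents V E).ncard := by
  let _ : Fintype (combComponents V E) := h.finite_combComponents.fintype
  rw [← fintype_card_eq_ncard]
  choose dv hdv using fun v : V => exists_dart_at (E := E) v.2
  have hcls : ∀ (v : V) (w : R3), w ∈ nbrs E v → cls V E (v, dv v) = cls V E (v, w) :=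
    fun v w hw => h.cls_fst (hdv v) (Or.inl hw) rfl
  refine finrank_ker_pairSum _ _ (fun v : V => (⟨cls V E (v, dv v), _, hdv v, rfl⟩ :
    combComponents V E)) ?_ ?_ ?_
  · rintro ⟨K, x, hx, rfl⟩
    exact ⟨⟨x.1, h.fst_mem hx⟩, Subtype.ext (h.cls_fst (hdv _) hx rfl)⟩
  · intro ε
    apply Subtype.ext
    simp only
    rw [hcls _ _ (mem_nbrs_of_ends hab ε), hcls _ _ (mem_nbrs_of_ends' hab ε)]
    exact cls_edge (mem_nbrs_of_ends hab ε)
  · intro f hf x y hxy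
    obtain ⟨F, hF⟩ := exists_extension f
    simp only [hF] at hf ⊢
    exact h.eq_of_cls_eq (φ := fun d => F d.1)
      (forall_nbrs_of_ends (φ := fun d => F d.1) hab hf) (fun v w hw => rfl)
      (hdv y) (congrArg Subtype.val hxy)

/-- Euler's formula, relating the numbers of faces, nodes, edges and components. -/
theorem IsFan.ncard_faces [Fintype V] [Fintype E] (h : IsFan V E)
    (hab : ∀ ε : E, (ε : Set R3) = {a ε, b ε}) :
    (topComponents (Y V E)).ncard + V.ncard =
      1 + E.ncard + (combComponents V E).ncard := by
  let _ : Fintype (topComponents (Y V E)) := h.finite_faces.fintype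
  let l : E → topComponents (Y V E) :=
    fun ε => ⟨dface V E (a ε, b ε), h.dface_mem (Or.inl (mem_nbrs_of_ends hab ε))⟩
  let r : E → topComponents (Y V E) :=
    fun ε => ⟨dface V E (b ε, a ε), h.dface_mem (Or.inl (mem_nbrs_of_ends' hab ε))⟩
  have hker : Module.finrank (ZMod 2) (LinearMap.ker (pairSum l r)) = 1 := by
    rw [← Fintype.card_unit]
    refine finrank_ker_pairSum l r (fun _ => ()) ?_ (fun _ => rfl) ?_
    · rintro ⟨⟩
      obtain ⟨v, hv⟩ := h.nonempty
      obtain ⟨w, hx⟩ := exists_dart_at (E := E) hv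
      exact ⟨⟨_, h.dface_mem hx⟩, rfl⟩
    · rintro f hf U U' -
      obtain ⟨F, hF⟩ := exists_extension f
      simp only [hF, l, r] at hf ⊢
      exact h.face_const (forall_nbrs_of_ends (φ := fun d => F (dface V E d)) hab hf) U.2 U'.2
  have := card_add_card_of_orthogonal l r (h.endA hab) (h.endB hab) fun z => by
    constructor
    · rintro ⟨g, hg⟩ f
      obtain ⟨G, hG⟩ := exists_extension g
      obtain ⟨F, hF⟩ := exists_extension f
      simp only [hG, hF, l, r] at hg ⊢
      simp only [← hg]
      exact h.sum_jump hab (G := fun d => G (dface V E d))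
        (fun v u hu => by rw [h.dface_sigma hu]) F
    · intro hz
      obtain ⟨g, hg⟩ := h.exists_jump hab z fun f => hz fun v => f v
      exact ⟨fun U => g U, hg⟩
  rw [hker, h.finrank_ker_coboundary hab] at this
  simpa only [fintype_card_eq_ncard] using this

/-- The number of incidences between faces and components. It is what Euler's formula gives when
each component is taken by itself: the faces incident to a component correspond to the faces of the
fan that consists of this component alone. -/
theorem IsFan.ncard_incidences [Fintype V] [Fintype E] (h : IsFan V E)
    (hab : ∀ ε : E, (ε : Set R3) = {a ε, b ε}) :
    (incidences V E).ncard + V.ncard = E.ncard + 2 * (combComponents V E).ncard := by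
  classical
  let _ : Fintype (incidences V E) := h.finite_incidences.fintype
  let _ : Fintype (combComponents V E) := h.finite_combComponents.fintype
  let l : E → incidences V E :=
    fun ε => ⟨_, (a ε, b ε), Or.inl (mem_nbrs_of_ends hab ε), rfl⟩
  let r : E → incidences V E :=
    fun ε => ⟨_, (b ε, a ε), Or.inl (mem_nbrs_of_ends' hab ε), rfl⟩
  have hsnd : ∀ i : incidences V E, i.1.2 ∈ combComponents V E := by
    rintro ⟨-, x, hx, rfl⟩
    exact ⟨x, hx, rfl⟩
  have hker : Module.finrank (ZMod 2) (LinearMap.ker (pairSum l r)) =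
      (combComponents V E).ncard := by
    rw [← fintype_card_eq_ncard]
    refine finrank_ker_pairSum l r
      (fun i => (⟨i.1.2, hsnd i⟩ : combComponents V E)) ?_ ?_ ?_
    · rintro ⟨K, x, hx, rfl⟩
      exact ⟨⟨_, x, hx, rfl⟩, rfl⟩
    · intro ε
      exact Subtype.ext (cls_edge (mem_nbrs_of_ends hab ε))
    · rintro f hf ⟨-, x, hx, rfl⟩ ⟨-, y, hy, rfl⟩ hxy
      have hxy : cls V E x = cls V E y := congrArg Subtype.val hxy
      obtain ⟨F, hF⟩ := exists_extension f
      simp only [hF, l, r] at hf ⊢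
      have hsymm := forall_nbrs_of_ends (φ := fun d => F (dface V E d, cls V E d)) hab hf
      refine h.eq_of_cls_eq (φ := fun d => F (dface V E d, cls V E d)) hsymm ?_ hy hxy
      intro v w hw
      rw [hsymm v _ (h.sigma_mem hw), h.dface_sigma hw, h.cls_sigma' hw]
  have := card_add_card_of_orthogonal l r (h.endA hab) (h.endB hab) fun z => by
    constructor
    · rintro ⟨g, hg⟩ f
      obtain ⟨G, hG⟩ := exists_extension g
      obtain ⟨F, hF⟩ := exists_extension f
      simp only [hG, hF, l, r] at hg ⊢
      simp only [← hg]
      exact h.sum_jump hab (G := fun d => G (dface V E d, cls V E d))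
        (fun v u hu => by rw [h.dface_sigma hu, h.cls_sigma' hu]) F
    · intro hz
      -- The part of an even set of edges in one combinatorial component is even.
      have hpart : ∀ K : Set (R3 × R3), ∃ g : Set R3 → ZMod 2, ∀ ε : E,
          g (dface V E (a ε, b ε)) + g (dface V E (b ε, a ε)) =
            if cls V E (a ε, b ε) = K then z ε else 0 := by
        intro K
        choose dv hdv using fun v : V => exists_dart_at (E := E) v.2
        have hcls : ∀ (v : V) (w : R3), w ∈ nbrs E v → cls V E (v, dv v) = cls V E (v, w) :=
          fun v w hw => h.cls_fst (hdv v) (Or.inl hw) rfl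
        refine h.exists_jump hab _ fun f => ?_
        refine Eq.trans (Finset.sum_congr rfl fun ε _ => ?_)
          (hz fun v => if cls V E (v, dv v) = K then f v else 0)
        rw [hcls _ _ (mem_nbrs_of_ends hab ε), hcls _ _ (mem_nbrs_of_ends' hab ε)]
        have e1 : cls V E ((h.endA hab ε : V), b ε) = cls V E (a ε, b ε) := rfl
        have e2 : cls V E ((h.endB hab ε : V), a ε) = cls V E (a ε, b ε) :=
          (cls_edge (mem_nbrs_of_ends hab ε)).symm
        rw [e1, e2]
        split_ifs
        · rfl
        · rw [zero_mul, add_zero, mul_zero]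
      choose g hg using hpart
      refine ⟨fun i => g i.1.2 i.1.1, fun ε => ?_⟩
      change g (cls V E (a ε, b ε)) _ + g (cls V E (b ε, a ε)) _ = z ε
      rw [← cls_edge (mem_nbrs_of_ends hab ε), hg, if_pos rfl]
  rw [hker, h.finrank_ker_coboundary hab] at this
  simp only [fintype_card_eq_ncard] at this
  rw [this]
  ring

end Count

/-! ### The sum of the weights -/

theorem IsFan.ncard_darts1 [Fintype E] (h : IsFan V E) {a b : E → R3}
    (hab : ∀ ε : E, (ε : Set R3) = {a ε, b ε}) : (darts1 V E).ncard = 2 * E.ncard := by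
  have := h.sum_darts1 hab (fun _ => 1)
  rw [Finset.sum_const, smul_eq_mul, mul_one, ← Set.ncard_eq_toFinset_card _ h.finite_darts1] at this
  rw [this, Finset.sum_const, Finset.card_univ, fintype_card_eq_ncard, smul_eq_mul]
  ring

/-- Every nonisolated dart leads into exactly one face. -/
theorem IsFan.sum_rU (h : IsFan V E) :
    ∑ U ∈ h.finite_faces.toFinset, rU V E U = (darts1 V E).ncard := by
  classical
  rw [Set.ncard_eq_toFinset_card _ h.finite_darts1]
  rw [Finset.card_eq_sum_card_fiberwise (f := dface V E) (t := h.finite_faces.toFinset)]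
  · refine Finset.sum_congr rfl fun U hU => ?_
    rw [Set.Finite.mem_toFinset] at hU
    rw [rU, ← Set.ncard_coe_finset]
    congr 1
    ext x
    rw [Set.mem_inter_iff, h.mem_dartsInto_iff hU, Finset.mem_coe, Finset.mem_filter,
      Set.Finite.mem_toFinset]
    exact ⟨fun hx => ⟨hx.2, hx.1.2⟩, fun hx => ⟨⟨Or.inl hx.1, hx.2⟩, hx.1⟩⟩
  · intro x hx
    rw [Finset.mem_coe, Set.Finite.mem_toFinset] at hx ⊢
    exact h.dface_mem (Or.inl hx)

theorem IsFan.sum_components (h : IsFan V E) :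
    ∑ U ∈ h.finite_faces.toFinset,
      {K ∈ combComponents V E | (K ∩ dartsInto V E U).Nonempty}.ncard =
        (incidences V E).ncard := by
  classical
  rw [Set.ncard_eq_toFinset_card _ h.finite_incidences]
  rw [Finset.card_eq_sum_card_fiberwise (f := Prod.fst) (t := h.finite_faces.toFinset)]
  · refine Finset.sum_congr rfl fun U hU => ?_
    rw [Set.Finite.mem_toFinset] at hU
    rw [← Set.ncard_coe_finset,
      ← Set.ncard_image_of_injective _ (Prod.mk_right_injective U)]
    congr 1
    ext ⟨U', K⟩
    rw [Finset.mem_coe, Finset.mem_filter, Set.Finite.mem_toFinset]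
    constructor
    · rintro ⟨K', ⟨⟨x, hx, rfl⟩, y, hyK, hyU⟩, heq⟩
      obtain ⟨rfl, rfl⟩ := Prod.mk.inj heq
      rw [h.mem_dartsInto_iff hU] at hyU
      refine ⟨⟨y, hyU.1, ?_⟩, rfl⟩
      simp only
      rw [hyU.2]
      exact Prod.ext rfl (cls_eq_of_eqvGen hyK.2).symm
    · rintro ⟨⟨x, hx, heq⟩, hU'⟩
      simp only at hU'
      subst hU'
      obtain ⟨h1, rfl⟩ := Prod.mk.inj heq
      exact ⟨_, ⟨⟨x, hx, rfl⟩, x, mem_cls_self hx, (h.mem_dartsInto_iff hU).2 ⟨hx, h1⟩⟩, rfl⟩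
  · intro i hx
    rw [Finset.mem_coe, Set.Finite.mem_toFinset] at hx ⊢
    obtain ⟨x, hx, rfl⟩ := hx
    exact h.dface_mem hx

/-- The combinatorial part of the weights adds up to an expression in the number of nodes. -/
theorem IsFan.sum_kU (h : IsFan V E) :
    ∑ U ∈ h.finite_faces.toFinset, (2 - (kU V E U : ℝ)) = 4 - 2 * V.ncard := by
  obtain ⟨a, b, hab⟩ := h.exists_ends
  let _ : Fintype E := h.finite_edges.fintype
  let _ : Fintype V := h.finite.fintype
  have e1 := h.ncard_faces hab
  have e2 := h.ncard_incidences hab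
  have e3 := h.sum_rU
  have e4 := h.sum_components
  rw [h.ncard_darts1 hab] at e3
  have e : ∀ U, (2 - (kU V E U : ℝ)) = 4 - (rU V E U : ℝ) -
      2 * ({K ∈ combComponents V E | (K ∩ dartsInto V E U).Nonempty}.ncard : ℝ) := by
    intro U
    unfold kU sU
    push_cast
    ring
  rw [Finset.sum_congr rfl fun U _ => e U, Finset.sum_sub_distrib, Finset.sum_sub_distrib,
    ← Finset.mul_sum, ← Nat.cast_sum, ← Nat.cast_sum, e3, e4, Finset.sum_const,
    ← Set.ncard_eq_toFinset_card _ h.finite_faces, nsmul_eq_mul]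
  have e1' : ((topComponents (Y V E)).ncard : ℝ) + V.ncard =
      1 + E.ncard + (combComponents V E).ncard := by exact_mod_cast e1
  have e2' : ((incidences V E).ncard : ℝ) + V.ncard =
      E.ncard + 2 * (combComponents V E).ncard := by exact_mod_cast e2
  push_cast
  linarith

open MeasureTheory in
theorem IsFan.volume_X (h : IsFan V E) : volume (X V E) = 0 := by
  refine (measure_biUnion_null_iff h.finite_edges.countable).2 fun ε hε => ?_
  obtain ⟨v, -, w, -, -, rfl⟩ := h.edges _ hε
  have hcr := h.cr_ne_zero hε
  refine measure_mono_null (t := (Submodule.span ℝ {v, w} : Set R3)) ?_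
    (Measure.addHaar_submodule _ _ fun htop => ?_)
  · intro p hp
    obtain ⟨s, t, -, -, rfl⟩ := mem_cone_pair.1 hp
    exact Submodule.mem_span_pair.2 ⟨s, t, rfl⟩
  · have hmem : cr v w ∈ Submodule.span ℝ {v, w} := htop ▸ Submodule.mem_top
    obtain ⟨s, t, hst⟩ := Submodule.mem_span_pair.1 hmem
    have := det3_cr v w
    rw [← hst, det3_comb_self, hst] at this
    have hN : 0 < ‖cr v w‖ ^ 2 := by positivity
    exact hN.ne this

theorem smul_mem_X {p : R3} (hp : p ∈ X V E) {t : ℝ} (ht : 0 ≤ t) : t • p ∈ X V E := by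
  obtain ⟨ε, hε, hpε⟩ := Set.mem_iUnion₂.1 hp
  exact Set.mem_iUnion₂.2 ⟨ε, hε, smul_mem_cone hpε ht⟩

open MeasureTheory in
/-- The solid angles of the faces add up to the area of the unit sphere. -/
theorem IsFan.sum_sol (h : IsFan V E) :
    ∑ U ∈ h.finite_faces.toFinset, sol U = 4 * Real.pi := by
  have hopen : ∀ U ∈ h.finite_faces.toFinset,
      IsOpen ((↑) ⁻¹' U : Set (Metric.sphere (0 : R3) 1)) := fun U hU =>
    (h.isOpen_face ((Set.Finite.mem_toFinset _).1 hU)).preimage continuous_subtype_val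
  have hdisj : ((h.finite_faces.toFinset : Finset (Set R3)) : Set (Set R3)).PairwiseDisjoint
      fun U => ((↑) ⁻¹' U : Set (Metric.sphere (0 : R3) 1)) := by
    intro U hU U' hU' hne
    rw [Finset.mem_coe, Set.Finite.mem_toFinset] at hU hU'
    refine Set.disjoint_left.2 fun p hp hp' => hne (eq_of_mem_topComponents hU hU' hp hp')
  have e1 : ∑ U ∈ h.finite_faces.toFinset, sol U =
      (volume : Measure R3).toSphere.real
        (⋃ U ∈ h.finite_faces.toFinset, ((↑) ⁻¹' U : Set (Metric.sphere (0 : R3) 1))) :=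
    (measureReal_biUnion_finset hdisj fun U hU => (hopen U hU).measurableSet).symm
  have e2 : (⋃ U ∈ h.finite_faces.toFinset, ((↑) ⁻¹' U : Set (Metric.sphere (0 : R3) 1))) =
      ((↑) ⁻¹' X V E : Set (Metric.sphere (0 : R3) 1))ᶜ := by
    ext p
    simp only [Set.mem_iUnion₂, Set.mem_compl_iff, Set.mem_preimage]
    constructor
    · rintro ⟨U, hU, hp⟩
      exact subset_of_topComponents ((Set.Finite.mem_toFinset _).1 hU) hp
    · intro hp
      exact ⟨connectedComponentIn (Y V E) p, (Set.Finite.mem_toFinset _).2 ⟨p, hp, rfl⟩,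
        mem_connectedComponentIn hp⟩
  have hXm : MeasurableSet ((↑) ⁻¹' X V E : Set (Metric.sphere (0 : R3) 1)) := by
    have hc : IsClosed (X V E) := by
      rw [← isOpen_compl_iff]; exact h.isOpen_Y
    exact (hc.preimage continuous_subtype_val).measurableSet
  have hX0 : (volume : Measure R3).toSphere ((↑) ⁻¹' X V E) = 0 := by
    rw [Measure.toSphere_apply' _ hXm]
    refine mul_eq_zero_of_right _ (measure_mono_null ?_ h.volume_X)
    rintro - ⟨t, ht, -, ⟨p, hp, rfl⟩, rfl⟩
    exact smul_mem_X hp ht.1.le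
  have hX1 : (volume : Measure R3).toSphere.real
      ((↑) ⁻¹' X V E : Set (Metric.sphere (0 : R3) 1)) = 0 := by
    rw [measureReal_def, hX0, ENNReal.toReal_zero]
  rw [e1, e2, measureReal_compl hXm, hX1, sub_zero, Measure.toSphere_real_apply_univ, measureReal_def, EuclideanSpace.volume_ball_fin_three]
  simp only [finrank_euclideanSpace, Fintype.card_fin]
  rw [ENNReal.toReal_mul, ENNReal.toReal_ofReal (by positivity)]
  simp
  ring

/-! ### The numerical value -/

theorem sin_three_mul_bounds {x l u : ℝ} (hl : 0 ≤ l) (h1 : l ≤ Real.sin x) (h2 : Real.sin x ≤ u)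
    (hu : u ≤ 1 / 2) : 3 * l - 4 * l ^ 3 ≤ Real.sin (3 * x) ∧
      Real.sin (3 * x) ≤ 3 * u - 4 * u ^ 3 := by
  rw [Real.sin_three_mul]
  set s := Real.sin x
  have mono : ∀ p q : ℝ, 0 ≤ p → p ≤ q → q ≤ 1 / 2 → 3 * p - 4 * p ^ 3 ≤ 3 * q - 4 * q ^ 3 := by
    intro p q hp hpq hq
    have hf : 0 ≤ 3 - 4 * (q ^ 2 + q * p + p ^ 2) := by nlinarith
    nlinarith [mul_nonneg (sub_nonneg.2 hpq) hf]
  exact ⟨mono _ _ hl h1 (h2.trans hu), mono _ _ (hl.trans h1) h2 hu⟩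

/-- Bounds for `sin (9 x)` from the cubic Taylor bounds at `x`. -/
theorem sin_nine_mul_bounds {x l u l' u' : ℝ} (hx0 : 0 ≤ x) (hx : x ≤ 1) (hl : 0 ≤ l)
    (h1 : l ≤ x - x ^ 3 / 6 - x ^ 5 / 100) (h2 : x - x ^ 3 / 6 + x ^ 5 / 100 ≤ u)
    (hu : u ≤ 1 / 2) (hl' : 0 ≤ l') (h1' : l' ≤ 3 * l - 4 * l ^ 3)
    (h2' : 3 * u - 4 * u ^ 3 ≤ u') (hu' : u' ≤ 1 / 2) :
    3 * l' - 4 * l' ^ 3 ≤ Real.sin (3 * (3 * x)) ∧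
      Real.sin (3 * (3 * x)) ≤ 3 * u' - 4 * u' ^ 3 := by
  have hb := abs_le.1 (Real.sin_bound (x := x) (by rwa [abs_of_nonneg hx0]))
  rw [abs_of_nonneg hx0] at hb
  obtain ⟨h3, h4⟩ := sin_three_mul_bounds (x := x) hl (by linarith [hb.1]) (by linarith [hb.2]) hu
  exact sin_three_mul_bounds hl' (h1'.trans h3) (h4.trans h2') hu'

/-- Bounds for `arcsin (1 / 3) = 0.33983690945…`. The upper bound has to be this sharp, since the
sum of the weights, `60 arcsin (1 / 3) - 6 π`, is about `1.5406586`. -/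
theorem arcsin_third_bounds :
    0.3398367 < Real.arcsin (1 / 3) ∧ Real.arcsin (1 / 3) < 0.33983693 := by
  have hpi := Real.pi_gt_three
  constructor
  · rw [Real.lt_arcsin_iff_sin_lt' ⟨by norm_num; linarith, by norm_num; linarith⟩]
    have := (sin_nine_mul_bounds (x := 0.3398367 / 9) (l := 0) (l' := 0) (u := 0.0377506613)
      (u' := 0.1130367882) (by norm_num) (by norm_num) (by norm_num) (by norm_num) (by norm_num)
      (by norm_num) (by norm_num) (by norm_num) (by norm_num) (by norm_num)).2
    rw [show (3 : ℝ) * (3 * (0.3398367 / 9)) = 0.3398367 by norm_num] at this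
    refine this.trans_lt ?_
    norm_num
  · rw [Real.arcsin_lt_iff_lt_sin' ⟨by norm_num; linarith, by norm_num; linarith⟩]
    have := (sin_nine_mul_bounds (x := 0.33983693 / 9) (l := 0.0377506852) (l' := 0.1130368594)
      (u := 1 / 10) (u' := 1 / 2)
      (by norm_num) (by norm_num) (by norm_num) (by norm_num) (by norm_num)
      (by norm_num) (by norm_num) (by norm_num) (by norm_num) (by norm_num)).1
    rw [show (3 : ℝ) * (3 * (0.33983693 / 9)) = 0.33983693 by norm_num] at this
    refine lt_of_lt_of_le ?_ this
    norm_num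

theorem tau_sum_bounds : |4 * Real.pi - 20 * sol0 - 1.54065| < 0.00001 := by
  have h1 := Real.pi_gt_d20
  have h2 := Real.pi_lt_d20
  obtain ⟨h3, h4⟩ := arcsin_third_bounds
  unfold sol0
  rw [Real.arccos_eq_pi_div_two_sub_arcsin, abs_lt]
  constructor <;> linarith

theorem isFan_E2 (h : V ∈ packings12') : IsFan V (E2 V) := by
  refine h.2.1.mono ?_
  rintro ε ⟨v, hv, w, hw, hd, rfl⟩
  refine ⟨v, hv, w, hw, hd.ge, ?_, rfl⟩
  rw [hd]
  exact Real.lt_sqrt_of_sq_lt (by norm_num)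

end KissingTwelve

end

theorem mainTheorem11 (V : Set KissingTwelve.R3) (hV : V ∈ KissingTwelve.packings12') :
    (KissingTwelve.topComponents (KissingTwelve.Y V (KissingTwelve.E2 V))).Finite ∧
    ∑ᶠ U ∈ KissingTwelve.topComponents (KissingTwelve.Y V (KissingTwelve.E2 V)),
        KissingTwelve.tau V U = 4 * Real.pi - 20 * KissingTwelve.sol0 ∧
    |4 * Real.pi - 20 * KissingTwelve.sol0 - 1.54065| < 0.00001 := by
  have h := KissingTwelve.isFan_E2 hV
  refine ⟨h.finite_faces, ?_, KissingTwelve.tau_sum_bounds⟩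
  have hcard : V.ncard = 12 := by
    rw [Set.ncard_def, hV.1.2.1]
    rfl
  rw [finsum_mem_eq_finite_toFinset_sum _ h.finite_faces]
  unfold KissingTwelve.tau
  rw [Finset.sum_add_distrib, ← Finset.sum_mul, h.sum_sol, h.sum_kU, hcard]
  norm_num
  ring
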